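/- **Setting.** A feedforward network is a finite acyclic graph of nodes. Each node receives signals from some of the inputs, earlier nodes and the constant $1$; every connection carries its own weight, and the node applies a function $a:\mathbb R^p\to\mathbb R$ to its $p$ weighted incoming signals (for example $a(z)=\sigma(z_1+\dots+z_p)$). The node is *Lipschitz bounded* if $|a(z)-a(z')|\le c\|z-z'\|$ for some constant $c$ and all $z,z'$. Let $R$ be a representation network $\mathbb R^d\to\mathbb R^k$ with $W_R\ge1$ weights and $O$ an output network $\mathbb R^k\to\mathbb R$ with $W_O\ge1$ weights, all of whose nodes are Lipschitz bounded. All weights range over $[-B,B]$ with $B\ge 0$. Let $X\subset\mathbb R^d$ be bounded. For each weight vector $u$ of $R$, giving the representation $f_u$, let $\mathcal H_u=\{g\circ f_u|_X\}$, where $g$ ranges over the functions computed by $O$ with admissible weights, and let $\mathbb H=\{\mathcal H_u\}$. Let $Y\subset\mathbb R$ be such that $(h(x)-y)^2\le1$ for all $h\in\mathcal H\in\mathbb H$, $x\in X$, $y\in Y$. For a probability measure $P$ on $X\times Y$ and $D=((x_1,y_1),\dots,(x_m,y_m))$ put $E(h,P)=\int (h(x)-y)^2\,dP$ and $\hat E(h,D)=\frac1m\sum_j(h(x_j)-y_j)^2$.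 Let $E^n=\frac1n\sum_iE(h_i,P_i)$ and $\hat E^n=\frac1n\sum_i\hat E(h_i,D_i)$. For a set $\mathcal P$ of probability measures on $X\times Y$ and a probability measure $Q$ on $\mathcal P$ let $\mathcal H^*(P)=\inf_{h\in\mathcal H}E(h,P)$ for $P\in\mathcal P$, $\mathbb H^*=\{\mathcal H^*:\mathcal H\in\mathbb H\}$, $E^*(\mathcal H,Q)=\int\mathcal H^*\,dQ$ and $\hat E^*(\mathcal H,D_1,\dots,D_n)=\frac1n\sum_i\inf_{h\in\mathcal H}\hat E(h,D_i)$. Let $[\mathbb H^n]_\sigma$ be the set of all functions $(x_i,y_i)_{i\le n}\mapsto\frac1n\sum_i(h_i(x_i)-y_i)^2$ with $h_1,\dots,h_n$ in a common $\mathcal H\in\mathbb H$. For a set $F$ of functions $Z\to[0,1]$ let $\mathcal C(\varepsilon,F)$ be the supremum, over all discrete probability measures $\mu$ on $Z$, of the least size of an $\varepsilon$-cover of $F$ (by elements of $F$) in the pseudo-metric $\int|f-f'|\,d\mu$. **Statement.** There is an absolute constant $K>0$ such that for all $R,O,B,X$ as above there is $\varepsilon_0\in(0,1)$ (depending only on $R,O,B,X$)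 with the following properties for all $Y$ as above, all $0<\varepsilon\le\varepsilon_0$, all $n\ge1$, $m\ge 0$, $0<\delta<1$, and all $\mathcal P,Q$. 1. $\ln\mathcal C(\varepsilon,[\mathbb H^n]_\sigma)\le K\,n\left(W_O+\frac{W_R}n\right)\ln\frac1\varepsilon$ and $\ln\mathcal C(\varepsilon,\mathbb H^*)\le K\,W_R\ln\frac1\varepsilon$; in particular both capacities are finite. 2. Put $M_n=\frac1{\varepsilon^2}\left[\left(W_O+\frac{W_R}n\right)\ln\frac1\varepsilon+\frac1n\ln\frac1\delta\right]$. If $m\ge K M_n$, then for all tasks $P_1,\dots,P_n$ and independent training sets $D_i\sim P_i^m$, with probability at least $1-\delta$ we have $|\hat E^n(h_1,\dots,h_n,D_1,\dots,D_n)-E^n(h_1,\dots,h_n,P_1,\dots,P_n)|\le\varepsilon$ simultaneously for all $h_1,\dots,h_n$ in a common $\mathcal H\in\mathbb H$. 3. With $a=\frac1{\varepsilon^2}\left[W_O\ln\frac1\varepsilon+\ln\frac1\delta\right]$ and $b=\frac1{\varepsilon^2}W_R\ln\frac1\varepsilon$ we have $M_n\le a+\frac bn$ and $M_1=a+b$.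 Moreover, for each fixed $\mathcal H\in\mathbb H$ (a known representation) and each $P$, if $m\ge Ka$ and $D\sim P^m$, then with probability at least $1-\delta$ we have $|\hat E(h,D)-E(h,P)|\le\varepsilon$ for all $h\in\mathcal H$. 4. Let $P_1,\dots,P_n$ be drawn independently from $Q$, and then $D_i\sim P_i^m$ independently. If $m\ge KM_n$ and $n\ge\frac K{\varepsilon^2}\left[W_R\ln\frac1\varepsilon+\ln\frac1\delta\right]$, then with probability at least $1-\delta$ we have $|\hat E^*(\mathcal H,D_1,\dots,D_n)-E^*(\mathcal H,Q)|\le\varepsilon$ for all $\mathcal H\in\mathbb H$, in particular for the one learnt by minimising $\hat E^*$. If $\delta\ge\varepsilon^{W_R}$, then $n\ge\frac K{\varepsilon^2}W_R\ln\frac1\varepsilon$ is enough in place of the condition on $n$. -/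

import Mathlib

open MeasureTheory ProbabilityTheory
open scoped NNReal ENNReal

noncomputable section

namespace BiasLearning

/-! ### Feedforward networks -/

/-- A function `a : ℝ^p → ℝ` is Lipschitz bounded if `|a x - a x'| ≤ c ‖x - x'‖` for some constant
`c`. (Which norm is used on `ℝ^p` only changes `c`.) -/
def LipschitzBounded {ι : Type} [Fintype ι] (a : (ι → ℝ) → ℝ) : Prop :=
  ∃ c : ℝ, ∀ x x' : ι → ℝ, |a x - a x'| ≤ c * ‖x - x'‖

/-- A feedforward (acyclic) graph of nodes. `Nodes d s` has `d` inputs and altogether `s` signals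
(the inputs and the outputs of the nodes). A new node is connected to a set `S` of earlier signals;
`none ∈ S` stands for the constant signal `1` (a threshold). Every connection carries its own
weight, and the node applies its node function `a` to the weighted signals; the usual choice is
`a z = σ (∑ e, z e)` with a squashing function `σ`. -/
inductive Nodes (d : ℕ) : ℕ → Type
  | input : Nodes d d
  | node {s : ℕ} (N : Nodes d s) (S : Finset (Option (Fin s))) (a : (S → ℝ) → ℝ) : Nodes d (s + 1)

namespace Nodes

/-- The set of weighted connections. -/
def Edge {d : ℕ} : {s : ℕ} → Nodes d s → Type
  | _, .input => Empty
  | _, .node N S _ => N.Edge ⊕ S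

/-- The number of weights, that is, of connections. -/
def numWeights {d : ℕ} : {s : ℕ} → Nodes d s → ℕ
  | _, .input => 0
  | _, .node N S _ => N.numWeights + S.card

/-- All the signals produced from the input `x` with weights `w`. -/
def signals {d : ℕ} : {s : ℕ} → (N : Nodes d s) → (N.Edge → ℝ) → (Fin d → ℝ) → Fin s → ℝ
  | _, .input, _, x => x
  | _, .node N S a, w, x =>
    Fin.snoc (α := fun _ => ℝ) (N.signals (fun e => w (Sum.inl e)) x)
      (a fun e : S => w (Sum.inr e) * e.1.elim 1 (N.signals (fun e => w (Sum.inl e)) x))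

/-- All the node functions are Lipschitz bounded. -/
def AllLipschitz {d : ℕ} : {s : ℕ} → Nodes d s → Prop
  | _, .input => True
  | _, .node N _ a => N.AllLipschitz ∧ LipschitzBounded a

end Nodes

/-- A feedforward network architecture with `d` inputs and `k` outputs. -/
structure Network (d k : ℕ) where
  size : ℕ
  nodes : Nodes d size
  out : Fin k → Fin size

namespace Network

variable {d k : ℕ}

/-- The total number of weights of the network. -/
def numWeights (N : Network d k) : ℕ := N.nodes.numWeights

/-- The admissible weight vectors: every weight lies in `[-B, B]`. -/
def weights (N : Network d k) (B : ℝ) : Set (N.nodes.Edge → ℝ) := {w | ∀ e, |w e| ≤ B}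

/-- The function computed by the network with weights `w`. -/
def eval (N : Network d k) (w : N.nodes.Edge → ℝ) (x : Fin d → ℝ) : Fin k → ℝ :=
  fun j => N.nodes.signals w x (N.out j)

end Network

/-- The hypothesis space of a fixed representation (the network `R` with weights `u`): all functions
on `X` obtained by attaching to it an output network `O` with weights in `[-B, B]`. -/
def hypothesisSpace {d k : ℕ} (R : Network d k) (O : Network k 1) (B : ℝ) (X : Set (Fin d → ℝ))
    (u : R.nodes.Edge → ℝ) : Set (X → ℝ) :=
  {h | ∃ v ∈ O.weights B, h = fun x : X => O.eval v (R.eval u x) 0}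

/-- The hypothesis space family `ℍ`: one hypothesis space for each representation. -/
def family {d k : ℕ} (R : Network d k) (O : Network k 1) (B : ℝ) (X : Set (Fin d → ℝ)) :
    Set (Set (X → ℝ)) :=
  {H | ∃ u ∈ R.weights B, H = hypothesisSpace R O B X u}

/-! ### Errors -/

section Errors

variable {X : Type} {Y : Set ℝ}

/-- The map `(x, y) ↦ (h(x) - y)²`. -/
def sqLoss (h : X → ℝ) (z : X × Y) : ℝ := (h z.1 - z.2) ^ 2

/-- The empirical error `Ê(h, D)`. -/
def empError {m : ℕ} (h : X → ℝ) (D : Fin m → X × Y) : ℝ :=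
  (1 / (m : ℝ)) * ∑ j, sqLoss h (D j)

/-- `Êⁿ(h₁, …, hₙ, D₁, …, Dₙ)`. -/
def empErrorN {n m : ℕ} (h : Fin n → X → ℝ) (D : Fin n → Fin m → X × Y) : ℝ :=
  (1 / (n : ℝ)) * ∑ i, empError (h i) (D i)

/-- `Ê*(H, D₁, …, Dₙ)`. -/
def empErrorStar {n m : ℕ} (H : Set (X → ℝ)) (D : Fin n → Fin m → X × Y) : ℝ :=
  (1 / (n : ℝ)) * ∑ i, ⨅ h : H, empError h.1 (D i)

variable [MeasurableSpace X]

/-- The true error `E(h, P)`. -/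
def trueError (h : X → ℝ) (P : ProbabilityMeasure (X × Y)) : ℝ :=
  ∫ z, sqLoss h z ∂(P : Measure (X × Y))

/-- `Eⁿ(h₁, …, hₙ, P₁, …, Pₙ)`. -/
def trueErrorN {n : ℕ} (h : Fin n → X → ℝ) (P : Fin n → ProbabilityMeasure (X × Y)) : ℝ :=
  (1 / (n : ℝ)) * ∑ i, trueError (h i) (P i)

/-- The function `H* : Tasks → [0,1]`, `H*(P) = inf_{h ∈ H} E(h, P)`. -/
def starFun (Tasks : Set (ProbabilityMeasure (X × Y))) (H : Set (X → ℝ)) (P : Tasks) : ℝ :=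
  ⨅ h : H, trueError h.1 P.1

/-- `E*(H, Q) = ∫ inf_{h ∈ H} E(h, P) dQ(P)`. -/
def trueErrorStar {Tasks : Set (ProbabilityMeasure (X × Y))} (H : Set (X → ℝ)) (Q : Measure Tasks) : ℝ :=
  ∫ P, starFun Tasks H P ∂Q

/-- The set of functions `ℍ*` on `Tasks`. -/
def starFamily (Tasks : Set (ProbabilityMeasure (X × Y))) (HH : Set (Set (X → ℝ))) : Set (Tasks → ℝ) :=
  {F | ∃ H ∈ HH, F = starFun Tasks H}

end Errors

/-- The set `[ℍⁿ]_σ` of the functions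
`(x₁, y₁, …, xₙ, yₙ) ↦ (1/n) ∑ᵢ (hᵢ(xᵢ) - yᵢ)²`, with all `hᵢ` in one common `H ∈ ℍ`. -/
def productFamily {X : Type} (Y : Set ℝ) (n : ℕ) (HH : Set (Set (X → ℝ))) :
    Set ((Fin n → X × Y) → ℝ) :=
  {F | ∃ H ∈ HH, ∃ h : Fin n → X → ℝ, (∀ i, h i ∈ H) ∧
    F = fun z => (1 / (n : ℝ)) * ∑ i, sqLoss (h i) (z i)}

/-! ### Capacity -/

/-- The pseudo-metric `d_P(f, g) = ∫ |f - g| dP` of a discrete probability measure `P`. -/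
@[reducible] def discretePseudoMetric {Z : Type} (P : PMF Z) : PseudoEMetricSpace (Z → ℝ) where
  edist f g := ∑' z, P z * edist (f z) (g z)
  edist_self f := by simp
  edist_comm f g := by simp only [edist_comm]
  edist_triangle f g h := by
    rw [← ENNReal.tsum_add]
    refine ENNReal.tsum_le_tsum fun z => ?_
    rw [← mul_add]
    gcongr
    exact edist_triangle _ _ _

/-- The `ε`-capacity: the supremum over all discrete probability measures `P` of the size of the
smallest `ε`-cover of `(F, d_P)`. -/
def capacity {Z : Type} (ε : ℝ) (F : Set (Z → ℝ)) : ℕ∞ :=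
  ⨆ P : PMF Z, @Metric.coveringNumber (Z → ℝ) (discretePseudoMetric P) ε.toNNReal F

/-! ### Sampling -/

section Sampling

variable {Z : Type} [MeasurableSpace Z]

/-- The law of `n` training sets of size `m`, the `i`-th one drawn independently from the task
`P i`. -/
def dataLaw {n : ℕ} (m : ℕ) (P : Fin n → ProbabilityMeasure Z) : Measure (Fin n → Fin m → Z) :=
  Measure.pi fun i => Measure.pi fun _ : Fin m => (P i : Measure Z)

theorem measurable_pi_of_measurable {α ι : Type} [MeasurableSpace α] [Fintype ι] {β : ι → Type}
    [∀ i, MeasurableSpace (β i)] (κ : (i : ι) → α → Measure (β i))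
    [∀ i a, IsProbabilityMeasure (κ i a)] (hκ : ∀ i, Measurable (κ i)) :
    Measurable fun a => Measure.pi fun i => κ i a := by
  refine Measurable.measure_of_isPiSystem_of_isProbabilityMeasure generateFrom_pi.symm
    isPiSystem_pi ?_
  rintro _ ⟨s, hs, rfl⟩
  simp only [Measure.pi_pi]
  exact Finset.measurable_prod _ fun i _ =>
    (Measure.measurable_coe (hs i (Set.mem_univ i))).comp (hκ i)

/-- The law of the training sets, as a Markov kernel from the tasks. -/
def dataKernel (Tasks : Set (ProbabilityMeasure Z)) (n m : ℕ) :
    Kernel (Fin n → Tasks) (Fin n → Fin m → Z) where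
  toFun P := dataLaw m fun i => (P i).1
  measurable' := by
    refine measurable_pi_of_measurable
      (fun i (P : Fin n → Tasks) => Measure.pi fun _ : Fin m => ((P i).1 : Measure Z)) fun i => ?_
    refine measurable_pi_of_measurable
      (fun (_ : Fin m) (P : Fin n → Tasks) => ((P i).1 : Measure Z)) fun _ => ?_
    exact measurable_subtype_coe.comp (measurable_subtype_coe.comp (measurable_pi_apply i))

/-- The law of the training sets `D₁, …, Dₙ` in the environment `(Tasks, Q)`: `P₁, …, Pₙ` are
drawn independently from `Q`, and then `Dᵢ` consists of `m` independent draws from `Pᵢ`. -/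
def environmentLaw {Tasks : Set (ProbabilityMeasure Z)} (Q : Measure Tasks) (n m : ℕ) :
    Measure (Fin n → Fin m → Z) :=
  (Measure.pi fun _ : Fin n => Q).bind (dataKernel Tasks n m)

end Sampling

/-- `ε⁻² [(W_O + W_R / n) ln (1/ε) + (1/n) ln (1/δ)]`. -/
def examplesPerTask (WO WR n : ℕ) (ε δ : ℝ) : ℝ :=
  1 / ε ^ 2 * (((WO : ℝ) + WR / n) * Real.log (1 / ε) + 1 / n * Real.log (1 / δ))

end BiasLearning

end

/-! The networks depend on finitely many weights, and on a bounded input set the dependence is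
Lipschitz: with weights in `[-B, B]` all signals stay bounded, and each node composes a Lipschitz
function with products of bounded factors (`exists_signals_lipschitz`). A grid in the weight cube
therefore gives, at scale `τ`, a finite net in the supremum norm with at most `(L / τ + 2) ^ W`
elements. The squared loss is at most 1, so it is 2-Lipschitz in the hypothesis and inherits such
nets (`exists_parametrization`). For small `ε` the constant `L` is absorbed into `(1/ε)^2`, so the
nets have size at most `ε^(-2W)`; this is where the absolute constant comes from. One net of
representations and `n` copies of a net of output functions give a net of tuples of size `ε^(-2(W_R
+ n W_O))`, and the saving over learning tasks separately is that `W_R` is counted once.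

A supremum-norm net is a net for every discrete measure, which bounds the capacities
(`capacity_range_le`). The generalisation bounds do not pass through the capacities: they follow
from Hoeffding's inequality at each net point and a union bound (`uniform_hoeffding_sample`,
`uniform_hoeffding_tasks`).

For novel tasks there are two stages (`environmentLaw_le`). The functions `H*` have a net indexed by
representations alone, because infima are 1-Lipschitz, so `n` sampled tasks represent `Q`. Given the
tasks, the bound for tuples passes to the infima through near-minimisers. A measurable bad event
over the net allows integration over the tasks. -/

noncomputable section

namespace BiasLearning

/-! ### Boundedness and Lipschitz dependence of the signals on weights and inputs. -/

namespace Nodes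

variable {d : ℕ}

/-- A network has finitely many connections. -/
instance fintypeEdge : {s : ℕ} → (N : Nodes d s) → Fintype N.Edge
  | _, .input => inferInstanceAs (Fintype Empty)
  | _, .node N S _ =>
    have := fintypeEdge N
    inferInstanceAs (Fintype (N.Edge ⊕ S))

theorem card_edge : {s : ℕ} → (N : Nodes d s) → Fintype.card N.Edge = N.numWeights
  | _, .input => Fintype.card_empty
  | _, .node N S _ => by
    have h : Fintype.card (N.Edge ⊕ S) = N.numWeights + S.card := by
      rw [Fintype.card_sum, card_edge N, Fintype.card_coe]
    exact h

theorem _root_.BiasLearning.LipschitzBounded.continuous {ι : Type} [Fintype ι]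
    {a : (ι → ℝ) → ℝ} (ha : LipschitzBounded a) : Continuous a := by
  obtain ⟨c, hc⟩ := ha
  refine (LipschitzWith.of_dist_le_mul (K := c.toNNReal) fun x y => ?_).continuous
  rw [Real.dist_eq, dist_eq_norm]
  exact (hc x y).trans (by gcongr; exact Real.le_coe_toNNReal c)

/-- Continuity in the input serves only to make the hypotheses measurable. -/
theorem continuous_signals {s : ℕ} (N : Nodes d s) (hN : N.AllLipschitz) (w : N.Edge → ℝ) :
    Continuous (N.signals w) := by
  induction N with
  | input => exact continuous_id
  | node N S a ih =>
    have ih := ih hN.1 fun e => w (Sum.inl e)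
    refine continuous_pi fun i => ?_
    simp only [signals]
    induction i using Fin.lastCases with
    | last =>
      simp only [Fin.snoc_last]
      refine hN.2.continuous.comp (continuous_pi fun e => continuous_const.mul ?_)
      obtain ⟨e, he⟩ := e
      cases e with
      | none => exact continuous_const
      | some j => exact (continuous_apply j).comp ih
    | cast j =>
      simp only [Fin.snoc_castSucc]
      exact (continuous_apply j).comp ih

/-- Induction on the nodes. The bound `M` must be carried along with `L`, since a product of weight
and signal is Lipschitz only while both factors are bounded. Inputs vary together with the weights
because an output network is fed by a perturbed representation. -/
theorem exists_signals_lipschitz {s : ℕ} (N : Nodes d s) (hN : N.AllLipschitz) (B C : ℝ) :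
    ∃ M L : ℝ, 0 ≤ M ∧ 0 ≤ L ∧
      (∀ w x, (∀ e, |w e| ≤ B) → (∀ i, |x i| ≤ C) → ∀ i, |N.signals w x i| ≤ M) ∧
      ∀ w w' x x' η, (∀ e, |w e| ≤ B) → (∀ e, |w' e| ≤ B) → (∀ i, |x i| ≤ C) → (∀ i, |x' i| ≤ C) →
        0 ≤ η → (∀ e, |w e - w' e| ≤ η) → (∀ i, |x i - x' i| ≤ η) →
        ∀ i, |N.signals w x i - N.signals w' x' i| ≤ L * η := by
  induction N with
  | input =>
    exact ⟨|C|, 1, abs_nonneg _, zero_le_one, fun w x _ hx i => (hx i).trans (le_abs_self C),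
      fun w w' x x' η _ _ _ _ _ _ h i => by simpa [signals] using h i⟩
  | node N S a ih =>
    obtain ⟨M, L, hM, hL, hb, hl⟩ := ih hN.1
    obtain ⟨c, hc⟩ := hN.2
    have hc' : ∀ (x x' : S → ℝ) (t : ℝ), 0 ≤ t → (∀ e, |x e - x' e| ≤ t) →
        |a x - a x'| ≤ |c| * t := by
      intro x x' t ht h
      have h1 : ‖x - x'‖ ≤ t := (pi_norm_le_iff_of_nonneg ht).2 fun e => by
        simpa [Real.norm_eq_abs] using h e
      exact (hc x x').trans (mul_le_mul (le_abs_self c) h1 (norm_nonneg _) (abs_nonneg _))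
    -- `M + 1` covers both the earlier signals and the constant signal `1`.
    have hb' : ∀ w x, (∀ e, |w e| ≤ B) → (∀ i, |x i| ≤ C) → ∀ o : Option (Fin _),
        |o.elim 1 (N.signals w x)| ≤ M + 1 := by
      intro w x hw hx o
      cases o with
      | none => simpa using hM
      | some j => exact (hb w x hw hx j).trans (by linarith)
    refine ⟨M + (|a 0| + |c| * (|B| * (M + 1))), L + |c| * ((M + 1) + |B| * L), by positivity,
      by positivity, ?_, ?_⟩
    · intro w x hw hx i
      simp only [signals]
      induction i using Fin.lastCases with
      | last =>
        simp only [Fin.snoc_last]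
        set z : S → ℝ := fun e => w (Sum.inr e) *
          e.1.elim 1 (N.signals (fun e => w (Sum.inl e)) x) with hz
        have h1 : |a z - a 0| ≤ |c| * (|B| * (M + 1)) := by
          refine hc' z 0 _ (by positivity) fun e => ?_
          rw [hz, Pi.zero_apply, sub_zero, abs_mul]
          exact mul_le_mul ((hw _).trans (le_abs_self B)) (hb' _ x (fun e => hw _) hx _)
            (abs_nonneg _) (abs_nonneg _)
        have h2 : |a z| ≤ |a z - a 0| + |a 0| := by
          simpa using abs_add_le (a z - a 0) (a 0)
        linarith
      | cast j =>
        simp only [Fin.snoc_castSucc]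
        have := hb (fun e => w (Sum.inl e)) x (fun e => hw _) hx j
        have h3 : 0 ≤ |a 0| + |c| * (|B| * (M + 1)) := by positivity
        linarith
    · intro w w' x x' η hw hw' hx hx' hη hww hxx i
      have hi := hl (fun e => w (Sum.inl e)) (fun e => w' (Sum.inl e)) x x' η (fun e => hw _)
        (fun e => hw' _) hx hx' hη (fun e => hww _) hxx
      simp only [signals]
      induction i using Fin.lastCases with
      | last =>
        simp only [Fin.snoc_last]
        have h1 := hc' (fun e => w (Sum.inr e) *
            e.1.elim 1 (N.signals (fun e => w (Sum.inl e)) x))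
          (fun e => w' (Sum.inr e) *
            e.1.elim 1 (N.signals (fun e => w' (Sum.inl e)) x')) (((M + 1) + |B| * L) * η)
          (by positivity) (by
            intro e
            set p := e.1.elim 1 (N.signals (fun e => w (Sum.inl e)) x) with hp
            set q := e.1.elim 1 (N.signals (fun e => w' (Sum.inl e)) x') with hq
            have hpM : |p| ≤ M + 1 := hb' _ x (fun e => hw _) hx _
            have hpq : |p - q| ≤ L * η := by
              rw [hp, hq]
              cases e.1 with
              | none => simpa using by positivity
              | some j => exact hi j
            have h2 : w (Sum.inr e) * p - w' (Sum.inr e) * q =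
                (w (Sum.inr e) - w' (Sum.inr e)) * p + w' (Sum.inr e) * (p - q) := by ring
            rw [h2]
            refine (abs_add_le _ _).trans ?_
            rw [abs_mul, abs_mul]
            have h3 := mul_le_mul (hww (Sum.inr e)) hpM (abs_nonneg _) hη
            have h4 := mul_le_mul ((hw' (Sum.inr e)).trans (le_abs_self B)) hpq (abs_nonneg _)
              (abs_nonneg _)
            linarith)
        have h5 : 0 ≤ L * η := by positivity
        linarith
      | cast j =>
        simp only [Fin.snoc_castSucc]
        have h5 : 0 ≤ |c| * ((M + 1) + |B| * L) * η := by positivity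
        linarith [hi j]

end Nodes

/-! ### Hypotheses as functions of the weights, and a grid in the weight cube. -/

/-- The hypothesis with representation weights `u` and output weights `v`. -/
def hypothesis {d k : ℕ} (R : Network d k) (O : Network k 1) (X : Set (Fin d → ℝ))
    (u : R.nodes.Edge → ℝ) (v : O.nodes.Edge → ℝ) (x : X) : ℝ :=
  O.eval v (R.eval u x) 0

theorem continuous_hypothesis {d k : ℕ} {R : Network d k} {O : Network k 1}
    (hR : R.nodes.AllLipschitz) (hO : O.nodes.AllLipschitz) (X : Set (Fin d → ℝ))
    (u : R.nodes.Edge → ℝ) (v : O.nodes.Edge → ℝ) : Continuous (hypothesis R O X u v) := by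
  have h1 : Continuous (R.eval u) :=
    continuous_pi fun j => (continuous_apply _).comp (R.nodes.continuous_signals hR u)
  exact ((continuous_apply _).comp (O.nodes.continuous_signals hO v)).comp
    (h1.comp continuous_subtype_val)

theorem exists_hypothesis_lipschitz {d k : ℕ} (R : Network d k) (O : Network k 1)
    (hR : R.nodes.AllLipschitz) (hO : O.nodes.AllLipschitz) (B : ℝ) {X : Set (Fin d → ℝ)}
    (hX : Bornology.IsBounded X) :
    ∃ L : ℝ, 0 < L ∧ ∀ u ∈ R.weights B, ∀ u' ∈ R.weights B, ∀ v ∈ O.weights B,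
      ∀ v' ∈ O.weights B, ∀ η, 0 ≤ η → (∀ e, |u e - u' e| ≤ η) → (∀ e, |v e - v' e| ≤ η) →
        ∀ x, |hypothesis R O X u v x - hypothesis R O X u' v' x| ≤ L * η := by
  obtain ⟨C, hC⟩ := hX.exists_norm_le
  have hC' : ∀ x ∈ X, ∀ i, |x i| ≤ C := fun x hx i => (norm_le_pi_norm x i).trans (hC x hx)
  obtain ⟨M, L, hM, hL, hb, hl⟩ := R.nodes.exists_signals_lipschitz hR B C
  obtain ⟨M', L', hM', hL', hb', hl'⟩ := O.nodes.exists_signals_lipschitz hO B M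
  refine ⟨L' * (L + 1) + 1, by positivity, ?_⟩
  intro u hu u' hu' v hv v' hv' η hη huu hvv x
  -- The inputs of `O` move by at most `L * η` and its weights by at most `η`; `(L + 1) * η`
  -- dominates both.
  have h1 := hl' v v' (R.eval u x) (R.eval u' x) ((L + 1) * η) hv hv'
    (fun i => hb u x hu (hC' x x.2) _) (fun i => hb u' x hu' (hC' x x.2) _) (by positivity)
    (fun e => (hvv e).trans (by nlinarith))
    (fun i => (hl u u' x x η hu hu' (hC' x x.2) (hC' x x.2) hη huu (by simpa using fun _ => hη)
      (R.out i)).trans (by nlinarith)) (O.out 0)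
  exact h1.trans (by nlinarith)

/-- The cube `[-B, B]^ι` has an `η`-net in the supremum norm with at most
`(2 B / η + 2) ^ #ι` points. -/
theorem exists_net_cube {ι : Type} [Fintype ι] {B η : ℝ} (hB : 0 ≤ B) (hη : 0 < η) :
    ∃ G : Finset {w : ι → ℝ // ∀ e, |w e| ≤ B},
      (G.card : ℝ) ≤ (2 * B / η + 2) ^ Fintype.card ι ∧
      ∀ w : {w : ι → ℝ // ∀ e, |w e| ≤ B}, ∃ g ∈ G, ∀ e, |w.1 e - g.1 e| ≤ η := by
  classical
  -- The grid points in each coordinate are `-B + j η` for `0 ≤ j ≤ N`; rounding down keeps them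
  -- inside `[-B, B]`.
  set N : ℕ := ⌊2 * B / η⌋₊ with hN
  have hpt : ∀ j : Fin (N + 1), |-B + j * η| ≤ B := by
    intro j
    have h1 : ((j : ℕ) : ℝ) ≤ N := by exact_mod_cast Nat.lt_succ_iff.1 j.2
    have h2 : (N : ℝ) ≤ 2 * B / η := Nat.floor_le (by positivity)
    have h3 : ((j : ℕ) : ℝ) * η ≤ 2 * B := by
      rw [← le_div_iff₀ hη]; exact h1.trans h2
    have h4 : 0 ≤ ((j : ℕ) : ℝ) * η := by positivity
    rw [abs_le]; constructor <;> linarith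
  let p : (ι → Fin (N + 1)) → {w : ι → ℝ // ∀ e, |w e| ≤ B} := fun f =>
    ⟨fun e => -B + (f e : ℕ) * η, fun e => hpt (f e)⟩
  refine ⟨Finset.univ.image p, ?_, ?_⟩
  · have h1 : (Finset.univ.image p).card ≤ (N + 1) ^ Fintype.card ι := by
      refine Finset.card_image_le.trans ?_
      simp
    have h2 : (N : ℝ) ≤ 2 * B / η := Nat.floor_le (by positivity)
    calc ((Finset.univ.image p).card : ℝ) ≤ ((N : ℝ) + 1) ^ Fintype.card ι := by exact_mod_cast h1
      _ ≤ _ := by gcongr; linarith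
  · intro w
    have hnn : ∀ e, 0 ≤ (w.1 e + B) / η := fun e =>
      div_nonneg (by linarith [(abs_le.1 (w.2 e)).1]) hη.le
    have hlt : ∀ e, ⌊(w.1 e + B) / η⌋₊ < N + 1 := fun e => by
      refine Nat.lt_succ_of_le (Nat.floor_le_floor ?_)
      gcongr
      linarith [(abs_le.1 (w.2 e)).2]
    refine ⟨p fun e => ⟨_, hlt e⟩, Finset.mem_image_of_mem _ (Finset.mem_univ _), fun e => ?_⟩
    have h1 := Nat.floor_le (hnn e)
    have h2 := (Nat.lt_floor_add_one ((w.1 e + B) / η)).le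
    rw [le_div_iff₀ hη] at h1
    rw [div_le_iff₀ hη] at h2
    simp only [p]
    rw [abs_le]
    constructor <;> linarith

/-! ### Uniform nets -/

/-- Every member of the family `f` is within `τ`, uniformly, of a member with index in `G`. -/
def IsUniformNet {A Z : Type*} (τ : ℝ) (f : A → Z → ℝ) (G : Finset A) : Prop :=
  ∀ a, ∃ b ∈ G, ∀ z, |f a z - f b z| ≤ τ

/-- Each `P` has total mass one, so a uniform distance bounds `d_P`. The net consists of members of
the family, as a cover by elements of `F` requires. -/
theorem capacity_range_le {A Z : Type} {ε : ℝ} {f : A → Z → ℝ} {G : Finset A}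
    (hG : IsUniformNet ε f G) : capacity ε (Set.range f) ≤ G.card := by
  classical
  refine iSup_le fun P => ?_
  let _ := discretePseudoMetric P
  have hcov : Metric.IsCover ε.toNNReal (Set.range f) ((G.image f : Finset (Z → ℝ)) : Set _) := by
    rintro _ ⟨a, rfl⟩
    obtain ⟨b, hb, hab⟩ := hG a
    refine ⟨f b, by simpa using ⟨b, hb, rfl⟩, ?_⟩
    change ∑' z, P z * edist (f a z) (f b z) ≤ _
    calc ∑' z, P z * edist (f a z) (f b z) ≤ ∑' z, P z * (ε.toNNReal : ℝ≥0∞) := by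
          refine ENNReal.tsum_le_tsum fun z => ?_
          gcongr
          rw [edist_dist, Real.dist_eq]
          exact ENNReal.ofReal_le_ofReal (hab z)
      _ = ε.toNNReal := by rw [ENNReal.tsum_mul_right, P.tsum_coe, one_mul]
  refine (hcov.coveringNumber_le_encard ?_).trans ?_
  · intro g hg
    obtain ⟨a, -, rfl⟩ := by simpa using hg
    exact ⟨a, rfl⟩
  · rw [Set.encard_coe_eq_coe_finsetCard]
    exact_mod_cast Finset.card_image_le

/-- Finiteness is recorded separately because `toNat` sends `⊤` to `0`; `hb` covers `c = 0`, where
`Real.log 0 = 0`. -/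
theorem log_toNat_le {c : ℕ∞} {N : ℕ} {b : ℝ} (hc : c ≤ N) (hN : Real.log N ≤ b) (hb : 0 ≤ b) :
    c ≠ ⊤ ∧ Real.log (c.toNat : ℝ) ≤ b := by
  refine ⟨ne_top_of_le_ne_top (ENat.natCast_ne_top N) hc, ?_⟩
  have h : c.toNat ≤ N := ENat.toNat_le_of_le_natCast hc
  rcases Nat.eq_zero_or_pos c.toNat with h0 | h0
  · simpa [h0] using hb
  · exact (Real.log_le_log (by exact_mod_cast h0) (by exact_mod_cast h)).trans hN

/-! ### Averages and infima -/

theorem abs_average_sub_le {n : ℕ} {f g : Fin n → ℝ} {τ : ℝ} (hτ : 0 ≤ τ)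
    (h : ∀ i, |f i - g i| ≤ τ) :
    |1 / (n : ℝ) * ∑ i, f i - 1 / (n : ℝ) * ∑ i, g i| ≤ τ := by
  rw [← mul_sub, ← Finset.sum_sub_distrib, abs_mul, abs_of_nonneg (by positivity)]
  rcases Nat.eq_zero_or_pos n with rfl | hn
  · simpa using hτ
  · have hn' : (0 : ℝ) < n := by exact_mod_cast hn
    have h1 : |∑ i, (f i - g i)| ≤ n * τ := by
      refine (Finset.abs_sum_le_sum_abs _ _).trans ?_
      calc ∑ i, |f i - g i| ≤ ∑ _i : Fin n, τ := Finset.sum_le_sum fun i _ => h i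
        _ = n * τ := by simp
    rw [one_div, inv_mul_le_iff₀ hn']
    exact h1

theorem abs_iInf_sub_iInf_le {V : Type*} [Nonempty V] {f g : V → ℝ} {τ : ℝ}
    (hf : ∀ v, 0 ≤ f v) (hg : ∀ v, 0 ≤ g v) (h : ∀ v, |f v - g v| ≤ τ) :
    |(⨅ v, f v) - ⨅ v, g v| ≤ τ := by
  have key : ∀ p q : V → ℝ, (∀ v, 0 ≤ p v) → (∀ v, |p v - q v| ≤ τ) →
      (⨅ v, p v) - τ ≤ ⨅ v, q v := by
    intro p q hp h
    refine le_ciInf fun v => ?_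
    have h1 : ⨅ v, p v ≤ p v := ciInf_le ⟨0, by rintro _ ⟨v, rfl⟩; exact hp v⟩ v
    linarith [(abs_le.1 (h v)).2]
  rw [abs_le]
  constructor
  · linarith [key g f hg fun v => by rw [abs_sub_comm]; exact h v]
  · linarith [key f g hf h]

/-- A bound for the difference of the averages of two sequences of functions, uniform over
the arguments, passes to the averages of the infima. -/
theorem abs_average_iInf_sub_le {V : Type*} [Nonempty V] {n : ℕ} (hn : 1 ≤ n)
    {f g : Fin n → V → ℝ} {τ : ℝ} (hf : ∀ i v, 0 ≤ f i v) (hg : ∀ i v, 0 ≤ g i v)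
    (h : ∀ v : Fin n → V, |1 / (n : ℝ) * ∑ i, f i (v i) - 1 / (n : ℝ) * ∑ i, g i (v i)| ≤ τ) :
    |1 / (n : ℝ) * ∑ i, (⨅ v, f i v) - 1 / (n : ℝ) * ∑ i, ⨅ v, g i v| ≤ τ := by
  have hn' : (0 : ℝ) < n := by exact_mod_cast hn
  have key : ∀ p q : Fin n → V → ℝ, (∀ i v, 0 ≤ p i v) →
      (∀ v : Fin n → V, |1 / (n : ℝ) * ∑ i, p i (v i) - 1 / (n : ℝ) * ∑ i, q i (v i)| ≤ τ) →
      1 / (n : ℝ) * ∑ i, (⨅ v, p i v) ≤ 1 / (n : ℝ) * ∑ i, (⨅ v, q i v) + τ := by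
    intro p q hp h
    refine le_of_forall_pos_le_add fun η hη => ?_
    -- Only the averages over tuples are close, not the individual terms, so near-minimisers for all
    -- `i` are chosen at once.
    have hex : ∀ i, ∃ v, q i v < (⨅ v, q i v) + η := fun i =>
      exists_lt_of_ciInf_lt (lt_add_of_pos_right _ hη)
    choose v hv using hex
    have h1 : 1 / (n : ℝ) * ∑ i, (⨅ v, p i v) ≤ 1 / (n : ℝ) * ∑ i, p i (v i) := by
      gcongr with i
      exact ciInf_le ⟨0, by rintro _ ⟨v, rfl⟩; exact hp i v⟩ _
    have h2 : 1 / (n : ℝ) * ∑ i, q i (v i) ≤ 1 / (n : ℝ) * ∑ i, ((⨅ v, q i v) + η) := by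
      gcongr with i
      exact (hv i).le
    have h3 : 1 / (n : ℝ) * ∑ i, ((⨅ v, q i v) + η) =
        1 / (n : ℝ) * ∑ i, (⨅ v, q i v) + η := by
      rw [Finset.sum_add_distrib, mul_add]
      simp [hn'.ne']
    linarith [(abs_le.1 (h v)).2]
  rw [abs_le]
  constructor
  · linarith [key g f hg fun v => by rw [abs_sub_comm]; exact h v]
  · linarith [key f g hf h]

/-- The infimum of a family of measurable functions that has finite uniform nets is measurable. -/
theorem measurable_iInf_of_nets {V Ω : Type*} [Nonempty V] [MeasurableSpace Ω] {f : V → Ω → ℝ}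
    (hf : ∀ v, Measurable (f v)) (h0 : ∀ v ω, 0 ≤ f v ω)
    (hnet : ∀ τ : ℝ, 0 < τ → ∃ G : Finset V, IsUniformNet τ f G) :
    Measurable fun ω => ⨅ v, f v ω := by
  -- The union of the nets at scales `1 / (k + 1)` is a countable index set with the same infimum.
  choose G hG using fun k : ℕ => hnet (1 / ((k : ℝ) + 1)) (by positivity)
  let C : Set V := ⋃ k, (G k : Set V)
  have hC : C.Countable := Set.countable_iUnion fun k => (G k).countable_toSet
  have : Countable C := hC.to_subtype
  have hCne : Nonempty C := by
    obtain ⟨b, hb, -⟩ := hG 0 (Classical.arbitrary V)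
    exact ⟨⟨b, Set.mem_iUnion.2 ⟨0, hb⟩⟩⟩
  have heq : (fun ω => ⨅ v, f v ω) = fun ω => ⨅ c : C, f c ω := by
    funext ω
    refine le_antisymm (le_ciInf fun c => ciInf_le ⟨0, by rintro _ ⟨v, rfl⟩; exact h0 v ω⟩ _)
      (le_ciInf fun v => le_of_forall_pos_le_add fun η hη => ?_)
    obtain ⟨k, hk⟩ := exists_nat_one_div_lt hη
    obtain ⟨b, hb, hvb⟩ := hG k v
    have h1 : ⨅ c : C, f c ω ≤ f b ω :=
      ciInf_le (f := fun c : C => f c ω) ⟨0, by rintro _ ⟨v, rfl⟩; exact h0 _ ω⟩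
        ⟨b, Set.mem_iUnion.2 ⟨k, hb⟩⟩
    linarith [(abs_le.1 (hvb ω)).1]
  rw [heq]
  exact Measurable.iInf fun c => hf c

/-! ### Concentration -/

theorem hasSubgaussianMGF_sum_pi {ι : Type*} [Fintype ι] {Ω : ι → Type*}
    [∀ i, MeasurableSpace (Ω i)] {μ : ∀ i, Measure (Ω i)} [∀ i, IsProbabilityMeasure (μ i)]
    {X : ∀ i, Ω i → ℝ} {c : ι → ℝ≥0} (h : ∀ i, HasSubgaussianMGF (X i) (c i) (μ i)) :
    HasSubgaussianMGF (fun ω => ∑ i, X i (ω i)) (∑ i, c i) (Measure.pi μ) := by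
  refine HasSubgaussianMGF.sum_of_iIndepFun (X := fun i (ω : ∀ i, Ω i) => X i (ω i))
    (iIndepFun_pi fun i => (h i).aemeasurable) fun i _ => ?_
  refine HasSubgaussianMGF.of_map (Y := Function.eval i) (X := X i)
    (measurable_pi_apply i).aemeasurable ?_
  rw [(measurePreserving_eval μ i).map_eq]
  exact h i

theorem measure_lt_abs_le {Ω : Type*} [MeasurableSpace Ω] {μ : Measure Ω} [IsFiniteMeasure μ]
    {X : Ω → ℝ} {c : ℝ≥0} (h : HasSubgaussianMGF X c μ) {t : ℝ} (ht : 0 ≤ t) :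
    μ {ω | t < |X ω|} ≤ ENNReal.ofReal (2 * Real.exp (-t ^ 2 / (2 * c))) := by
  have h1 := h.measure_ge_le ht
  have h2 := h.neg.measure_ge_le ht
  have hsub : {ω | t < |X ω|} ⊆ {ω | t ≤ X ω} ∪ {ω | t ≤ (-X) ω} := by
    intro ω hω
    rw [Set.mem_ofPred_eq] at hω
    rcases lt_abs.1 hω with h | h
    · exact Or.inl h.le
    · exact Or.inr h.le
  rw [← ofReal_measureReal]
  refine ENNReal.ofReal_le_ofReal ?_
  have h3 := (measureReal_mono hsub (μ := μ)).trans (measureReal_union_le _ _)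
  linarith

/-- Hoeffding's lemma; `1 / 4` is the square of half the length of `[0, 1]`. -/
theorem hasSubgaussianMGF_sub_integral {Z : Type*} [MeasurableSpace Z] {μ : Measure Z}
    [IsProbabilityMeasure μ] {f : Z → ℝ} (hf : Measurable f) (h0 : ∀ z, 0 ≤ f z)
    (h1 : ∀ z, f z ≤ 1) : HasSubgaussianMGF (fun z => f z - ∫ z, f z ∂μ) (1 / 4) μ := by
  have h := hasSubgaussianMGF_of_mem_Icc (μ := μ) (a := 0) (b := 1) hf.aemeasurable
    (Filter.Eventually.of_forall fun z => ⟨h0 z, h1 z⟩)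
  convert h using 1
  simp
  norm_num

/-- Hoeffding's inequality for `n` independent samples from one distribution. -/
theorem hoeffding_sample {Z : Type*} [MeasurableSpace Z] {n : ℕ} (hn : 1 ≤ n) (μ : Measure Z)
    [IsProbabilityMeasure μ] {f : Z → ℝ} (hf : Measurable f) (h0 : ∀ z, 0 ≤ f z)
    (h1 : ∀ z, f z ≤ 1) {t : ℝ} (ht : 0 ≤ t) :
    (Measure.pi fun _ : Fin n => μ) {D | t < |1 / (n : ℝ) * ∑ j, f (D j) - ∫ z, f z ∂μ|} ≤
      ENNReal.ofReal (2 * Real.exp (-2 * n * t ^ 2)) := by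
  have hn' : (0 : ℝ) < n := by exact_mod_cast hn
  have hs := hasSubgaussianMGF_sum_pi (μ := fun _ : Fin n => μ)
    (fun _ => hasSubgaussianMGF_sub_integral (μ := μ) hf h0 h1)
  have htail := measure_lt_abs_le hs (t := n * t) (by positivity)
  convert htail using 3
  · funext D
    have h2 : ∑ i, (f (D i) - ∫ z, f z ∂μ) =
        n * (1 / (n : ℝ) * ∑ j, f (D j) - ∫ z, f z ∂μ) := by
      rw [Finset.sum_sub_distrib]
      field_simp
      simp
    rw [h2, abs_mul, abs_of_pos hn', mul_lt_mul_iff_right₀ hn']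
  · congr 1
    push_cast
    simp
    field_simp
    ring

/-- Hoeffding's inequality for `m` independent samples from each of `n` distributions. -/
theorem hoeffding_tasks {Z : Type} [MeasurableSpace Z] {n m : ℕ} (hn : 1 ≤ n) (hm : 1 ≤ m)
    (P : Fin n → ProbabilityMeasure Z) {f : Fin n → Z → ℝ} (hf : ∀ i, Measurable (f i))
    (h0 : ∀ i z, 0 ≤ f i z) (h1 : ∀ i z, f i z ≤ 1) {t : ℝ} (ht : 0 ≤ t) :
    dataLaw m P {D | t < |1 / (n : ℝ) * ∑ i, (1 / (m : ℝ) * ∑ j, f i (D i j)) -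
        1 / (n : ℝ) * ∑ i, ∫ z, f i z ∂(P i : Measure Z)|} ≤
      ENNReal.ofReal (2 * Real.exp (-2 * (n * m) * t ^ 2)) := by
  have hn' : (0 : ℝ) < n := by exact_mod_cast hn
  have hm' : (0 : ℝ) < m := by exact_mod_cast hm
  have hs := hasSubgaussianMGF_sum_pi (μ := fun i => Measure.pi fun _ : Fin m => (P i : Measure Z))
    (fun i => hasSubgaussianMGF_sum_pi (μ := fun _ : Fin m => (P i : Measure Z))
      (fun _ => hasSubgaussianMGF_sub_integral (μ := (P i : Measure Z)) (hf i) (h0 i) (h1 i)))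
  -- The variance proxies add up to `n m / 4`, so the exponent is `-(n m t)² / (n m / 2) = -2 n m
  -- t²`.
  have htail := measure_lt_abs_le hs (t := (n * m) * t) (by positivity)
  rw [dataLaw]
  convert htail using 3
  · funext D
    have h2 : ∑ i, ∑ j, (f i (D i j) - ∫ z, f i z ∂(P i : Measure Z)) =
        (n * m) * (1 / (n : ℝ) * ∑ i, (1 / (m : ℝ) * ∑ j, f i (D i j)) -
        1 / (n : ℝ) * ∑ i, ∫ z, f i z ∂(P i : Measure Z)) := by
      simp_rw [Finset.sum_sub_distrib, ← Finset.mul_sum]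
      simp only [Finset.sum_const, Finset.card_univ, Fintype.card_fin, nsmul_eq_mul,
        ← Finset.mul_sum]
      field_simp
    rw [h2, abs_mul, abs_of_pos (mul_pos hn' hm'), mul_lt_mul_iff_right₀ (mul_pos hn' hm')]
  · congr 1
    push_cast
    simp
    field_simp
    ring

/-- `T` will be a union over a possibly uncountable family; only monotonicity and subadditivity are
used, so no measurability is required. -/
theorem measure_biUnion_finset_le_ofReal {Ω A : Type*} [MeasurableSpace Ω] {μ : Measure Ω}
    (G : Finset A) {S : A → Set Ω} {T : Set Ω} {c : ℝ} (hS : ∀ a ∈ G, μ (S a) ≤ ENNReal.ofReal c)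
    (hT : T ⊆ ⋃ a ∈ G, S a) : μ T ≤ ENNReal.ofReal (G.card * c) := by
  calc μ T ≤ μ (⋃ a ∈ G, S a) := measure_mono hT
    _ ≤ ∑ a ∈ G, μ (S a) := measure_biUnion_finset_le _ _
    _ ≤ ∑ _a ∈ G, ENNReal.ofReal c := Finset.sum_le_sum hS
    _ = ENNReal.ofReal (G.card * c) := by
      rw [Finset.sum_const, nsmul_eq_mul, ENNReal.ofReal_mul (by positivity),
        ENNReal.ofReal_natCast]

theorem abs_integral_sub_le {Z : Type*} [MeasurableSpace Z] {μ : Measure Z}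
    [IsProbabilityMeasure μ] {f g : Z → ℝ} (hf : Measurable f) (hg : Measurable g)
    (hf0 : ∀ z, 0 ≤ f z) (hf1 : ∀ z, f z ≤ 1) (hg0 : ∀ z, 0 ≤ g z) (hg1 : ∀ z, g z ≤ 1)
    {τ : ℝ} (h : ∀ z, |f z - g z| ≤ τ) : |∫ z, f z ∂μ - ∫ z, g z ∂μ| ≤ τ := by
  have hi : ∀ p : Z → ℝ, Measurable p → (∀ z, 0 ≤ p z) → (∀ z, p z ≤ 1) → Integrable p μ :=
    fun p hp h0 h1 => Integrable.of_mem_Icc 0 1 hp.aemeasurable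
      (Filter.Eventually.of_forall fun z => ⟨h0 z, h1 z⟩)
  rw [← integral_sub (hi f hf hf0 hf1) (hi g hg hg0 hg1)]
  have := norm_integral_le_of_norm_le_const (μ := μ) (f := fun z => f z - g z) (C := τ)
    (Filter.Eventually.of_forall h)
  simpa using this

/-- Uniform convergence of sample averages over a family of functions with a finite net. -/
theorem uniform_hoeffding_sample {Z A : Type*} [MeasurableSpace Z] {n : ℕ} (hn : 1 ≤ n)
    (μ : Measure Z) [IsProbabilityMeasure μ] {f : A → Z → ℝ} (hf : ∀ a, Measurable (f a))
    (h0 : ∀ a z, 0 ≤ f a z) (h1 : ∀ a z, f a z ≤ 1) {τ t : ℝ} (hτ : 0 ≤ τ) (ht : 0 ≤ t)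
    {G : Finset A} (hG : IsUniformNet τ f G) :
    (Measure.pi fun _ : Fin n => μ)
      {D | ∃ a, t + 2 * τ < |1 / (n : ℝ) * ∑ j, f a (D j) - ∫ z, f a z ∂μ|} ≤
      ENNReal.ofReal (G.card * (2 * Real.exp (-2 * n * t ^ 2))) := by
  refine measure_biUnion_finset_le_ofReal G
    (fun a _ => hoeffding_sample hn μ (hf a) (h0 a) (h1 a) ht) ?_
  rintro D ⟨a, ha⟩
  obtain ⟨b, hb, hab⟩ := hG a
  refine Set.mem_iUnion₂.2 ⟨b, hb, ?_⟩
  have h2 := abs_average_sub_le hτ (f := fun j => f a (D j)) (g := fun j => f b (D j))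
    fun j => hab (D j)
  have h3 := abs_integral_sub_le (μ := μ) (hf a) (hf b) (h0 a) (h1 a) (h0 b) (h1 b) hab
  simp only [Set.mem_ofPred_eq] at ha ⊢
  rw [abs_le] at h2 h3
  rcases lt_abs.1 ha with h | h
  · exact lt_abs.2 (Or.inl (by linarith))
  · exact lt_abs.2 (Or.inr (by linarith))

/-- Uniform convergence, over a family of tuples of functions with a finite net, of averages of
samples from several tasks. -/
theorem uniform_hoeffding_tasks {Z : Type} {A : Type*} [MeasurableSpace Z] {n m : ℕ} (hn : 1 ≤ n)
    (hm : 1 ≤ m) (P : Fin n → ProbabilityMeasure Z) {f : A → Fin n × Z → ℝ}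
    (hf : ∀ a i, Measurable fun z => f a (i, z)) (h0 : ∀ a z, 0 ≤ f a z) (h1 : ∀ a z, f a z ≤ 1)
    {τ t : ℝ} (hτ : 0 ≤ τ) (ht : 0 ≤ t) {G : Finset A} (hG : IsUniformNet τ f G) :
    dataLaw m P {D | ∃ a, t + 2 * τ <
        |1 / (n : ℝ) * ∑ i, (1 / (m : ℝ) * ∑ j, f a (i, D i j)) -
          1 / (n : ℝ) * ∑ i, ∫ z, f a (i, z) ∂(P i : Measure Z)|} ≤
      ENNReal.ofReal (G.card * (2 * Real.exp (-2 * (n * m) * t ^ 2))) := by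
  refine measure_biUnion_finset_le_ofReal G
    (fun a _ => hoeffding_tasks hn hm P (hf a) (fun i z => h0 a (i, z)) (fun i z => h1 a (i, z))
      ht) ?_
  rintro D ⟨a, ha⟩
  obtain ⟨b, hb, hab⟩ := hG a
  refine Set.mem_iUnion₂.2 ⟨b, hb, ?_⟩
  have h2 := abs_average_sub_le hτ (f := fun i => 1 / (m : ℝ) * ∑ j, f a (i, D i j))
    (g := fun i => 1 / (m : ℝ) * ∑ j, f b (i, D i j))
    fun i => abs_average_sub_le hτ fun j => hab (i, D i j)
  have h3 := abs_average_sub_le hτ (f := fun i => ∫ z, f a (i, z) ∂(P i : Measure Z))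
    (g := fun i => ∫ z, f b (i, z) ∂(P i : Measure Z))
    fun i => abs_integral_sub_le (hf a i) (hf b i) (fun z => h0 a _) (fun z => h1 a _)
      (fun z => h0 b _) (fun z => h1 b _) fun z => hab (i, z)
  simp only [Set.mem_ofPred_eq] at ha ⊢
  rw [abs_le] at h2 h3
  rcases lt_abs.1 ha with h | h
  · exact lt_abs.2 (Or.inl (by linarith))
  · exact lt_abs.2 (Or.inr (by linarith))

/-- A union bound over at most `ε⁻²ᵂ` events is at most `δ / 2` for samples of size
`8 ε⁻² (4 W ln (1/ε) + ln (1/δ))`. -/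
theorem card_mul_exp_le {N W : ℕ} {ε δ M : ℝ} (hW : 1 ≤ W) (hε : 0 < ε) (hε2 : ε ≤ 1 / 2)
    (hδ : 0 < δ) (hN : (N : ℝ) ≤ (1 / ε) ^ (2 * W))
    (hM : 8 * (1 / ε ^ 2 * (4 * W * Real.log (1 / ε) + Real.log (1 / δ))) ≤ M) :
    N * (2 * Real.exp (-2 * M * (ε / 4) ^ 2)) ≤ δ / 2 := by
  have hW' : (1 : ℝ) ≤ W := by exact_mod_cast hW
  have h2 : (2 : ℝ) ≤ 1 / ε := by rw [le_div_iff₀ hε]; linarith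
  -- With `q = (1/ε)^(2W)` the exponential is at most `q⁻² δ`. One factor `q` pays for the union
  -- bound, and `q ≥ 4` turns the remaining `2δ / q` into `δ / 2`.
  have h4 : (4 : ℝ) ≤ (1 / ε) ^ (2 * W) := by
    calc (4 : ℝ) = 2 ^ (2 * 1) := by norm_num
      _ ≤ (1 / ε) ^ (2 * 1) := by gcongr
      _ ≤ (1 / ε) ^ (2 * W) := by gcongr; linarith
  have hexp : Real.exp (-2 * M * (ε / 4) ^ 2) ≤
      ((1 / ε) ^ (2 * W) * (1 / ε) ^ (2 * W))⁻¹ * δ := by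
    have h5 : -2 * M * (ε / 4) ^ 2 ≤ -(4 * W * Real.log (1 / ε) + Real.log (1 / δ)) := by
      have h6 : 8 * (1 / ε ^ 2 * (4 * W * Real.log (1 / ε) + Real.log (1 / δ))) * (ε ^ 2 / 8) =
          4 * W * Real.log (1 / ε) + Real.log (1 / δ) := by field_simp
      have h7 := mul_le_mul_of_nonneg_right hM (by positivity : 0 ≤ ε ^ 2 / 8)
      rw [h6] at h7
      nlinarith
    refine (Real.exp_le_exp.2 h5).trans_eq ?_
    have h8 : Real.log (1 / δ) = -Real.log δ := by rw [one_div, Real.log_inv]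
    have h9 : 4 * W * Real.log (1 / ε) = Real.log ((1 / ε) ^ (2 * W) * (1 / ε) ^ (2 * W)) := by
      rw [← pow_add, Real.log_pow]; push_cast; ring
    rw [h9, h8, neg_add, neg_neg, Real.exp_add, Real.exp_neg, Real.exp_log (by positivity),
      Real.exp_log hδ]
  set q := (1 / ε) ^ (2 * W) with hq
  have hq0 : 0 < q := by linarith
  calc N * (2 * Real.exp (-2 * M * (ε / 4) ^ 2)) ≤ q * (2 * ((q * q)⁻¹ * δ)) := by gcongr
    _ = 2 * δ / q := by field_simp
    _ ≤ δ / 2 := by rw [div_le_iff₀ hq0]; nlinarith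

/-! ### Nets for the squared loss and bounds for the capacities. -/

section Loss

variable {X U V : Type} {Y : Set ℝ} {h : U → V → X → ℝ} {τ : ℝ} {GU : Finset U} {GV : Finset V}

theorem sqLoss_nonneg (f : X → ℝ) (z : X × Y) : 0 ≤ sqLoss f z := sq_nonneg _

theorem empError_nonneg {m : ℕ} (f : X → ℝ) (D : Fin m → X × Y) : 0 ≤ empError f D :=
  mul_nonneg (by positivity) (Finset.sum_nonneg fun _ _ => sqLoss_nonneg _ _)

/-- Factor the difference of squares; both residuals have absolute value at most 1. -/
theorem abs_sqLoss_sub_le {f g : X → ℝ} {z : X × Y} (hf : sqLoss f z ≤ 1) (hg : sqLoss g z ≤ 1) :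
    |sqLoss f z - sqLoss g z| ≤ 2 * |f z.1 - g z.1| := by
  unfold sqLoss at *
  have h1 : |f z.1 - z.2| ≤ 1 := (sq_le_one_iff_abs_le_one _).1 hf
  have h2 : |g z.1 - z.2| ≤ 1 := (sq_le_one_iff_abs_le_one _).1 hg
  have h3 : (f z.1 - z.2) ^ 2 - (g z.1 - z.2) ^ 2 =
      ((f z.1 - z.2) + (g z.1 - z.2)) * (f z.1 - g z.1) := by ring
  rw [h3, abs_mul]
  gcongr
  exact (abs_add_le _ _).trans (by linarith)

/-- Nets of the representations and of the output functions combine to a net of the tuples of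
hypotheses with a common representation. -/
theorem isUniformNet_tuples (n : ℕ)
    (hGU : IsUniformNet τ (fun u (p : V × (X × Y)) => sqLoss (h u p.1) p.2) GU)
    (hGV : IsUniformNet τ (fun v (p : U × (X × Y)) => sqLoss (h p.1 v) p.2) GV) :
    IsUniformNet (2 * τ) (fun (a : U × (Fin n → V)) (p : Fin n × (X × Y)) =>
      sqLoss (h a.1 (a.2 p.1)) p.2) (GU ×ˢ Fintype.piFinset fun _ => GV) := by
  rintro ⟨u, v⟩
  obtain ⟨u', hu', huu⟩ := hGU u
  choose v' hv' hvv using fun i => hGV (v i)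
  refine ⟨(u', v'), Finset.mem_product.2 ⟨hu', Fintype.mem_piFinset.2 hv'⟩, ?_⟩
  rintro ⟨i, z⟩
  have h1 := huu (v i, z)
  have h2 := hvv i (u', z)
  have h3 := abs_sub_le (sqLoss (h u (v i)) z) (sqLoss (h u' (v i)) z) (sqLoss (h u' (v' i)) z)
  simp only at h1 h2 ⊢
  linarith

theorem card_tuples (n : ℕ) (GU : Finset U) (GV : Finset V) :
    (GU ×ˢ Fintype.piFinset fun _ : Fin n => GV).card = GU.card * GV.card ^ n := by
  simp [Finset.card_product]

theorem productFamily_range (n : ℕ) :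
    productFamily Y n (Set.range fun u => Set.range (h u)) =
      Set.range fun (a : U × (Fin n → V)) (z : Fin n → X × Y) =>
        1 / (n : ℝ) * ∑ i, sqLoss (h a.1 (a.2 i)) (z i) := by
  ext F
  constructor
  · rintro ⟨_, ⟨u, rfl⟩, f, hf, rfl⟩
    choose v hv using hf
    exact ⟨(u, v), by simp [hv]⟩
  · rintro ⟨⟨u, v⟩, rfl⟩
    exact ⟨_, ⟨u, rfl⟩, fun i => h u (v i), fun i => ⟨v i, rfl⟩, rfl⟩

theorem capacity_productFamily_le (n : ℕ) (hτ : 0 ≤ τ)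
    (hGU : IsUniformNet τ (fun u (p : V × (X × Y)) => sqLoss (h u p.1) p.2) GU)
    (hGV : IsUniformNet τ (fun v (p : U × (X × Y)) => sqLoss (h p.1 v) p.2) GV) {ε : ℝ}
    (hε : 2 * τ ≤ ε) :
    capacity ε (productFamily Y n (Set.range fun u => Set.range (h u))) ≤
      (GU.card * GV.card ^ n : ℕ) := by
  rw [productFamily_range, ← card_tuples]
  refine capacity_range_le fun a => ?_
  obtain ⟨b, hb, hab⟩ := isUniformNet_tuples n hGU hGV a
  exact ⟨b, hb, fun z =>
    (abs_average_sub_le (by positivity) fun i => hab (i, z i)).trans hε⟩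

theorem empErrorStar_range {n m : ℕ} (u : U) (D : Fin n → Fin m → X × Y) :
    empErrorStar (Set.range (h u)) D = 1 / (n : ℝ) * ∑ i, ⨅ v, empError (h u v) (D i) := by
  unfold empErrorStar
  congr 2
  funext i
  exact iInf_range' (fun f => empError f (D i)) (h u)

/-! ### True errors, measurability and uniform convergence. -/

variable [MeasurableSpace X]

theorem measurable_sqLoss {f : X → ℝ} (hf : Measurable f) :
    Measurable (sqLoss f : X × Y → ℝ) :=
  ((hf.comp measurable_fst).sub (measurable_subtype_coe.comp measurable_snd)).pow_const 2

theorem measurable_empError {m : ℕ} {f : X → ℝ} (hf : Measurable f) :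
    Measurable (empError f : (Fin m → X × Y) → ℝ) :=
  (Finset.measurable_sum _ fun j _ =>
    (measurable_sqLoss hf).comp (measurable_pi_apply j)).const_mul _

theorem trueError_nonneg (f : X → ℝ) (P : ProbabilityMeasure (X × Y)) : 0 ≤ trueError f P :=
  integral_nonneg fun z => sqLoss_nonneg f z

theorem trueError_le_one {f : X → ℝ} (hf1 : ∀ z : X × Y, sqLoss f z ≤ 1)
    (P : ProbabilityMeasure (X × Y)) : trueError f P ≤ 1 := by
  have := norm_integral_le_of_norm_le_const (μ := (P : Measure (X × Y))) (f := sqLoss f) (C := 1)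
    (Filter.Eventually.of_forall fun z => by
      rw [Real.norm_of_nonneg (sqLoss_nonneg f z)]; exact hf1 z)
  rw [measureReal_def, measure_univ, ENNReal.toReal_one, mul_one] at this
  exact (le_abs_self _).trans this

theorem measurable_trueError (Tasks : Set (ProbabilityMeasure (X × Y))) {f : X → ℝ}
    (hf : Measurable f) : Measurable fun P : Tasks => trueError f P.1 := by
  let κ : Kernel Tasks (X × Y) :=
    ⟨fun P => (P.1 : Measure (X × Y)), measurable_subtype_coe.comp measurable_subtype_coe⟩
  have hκ : IsMarkovKernel κ := ⟨fun P => P.1.2⟩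
  exact (StronglyMeasurable.integral_kernel (κ := κ)
    (measurable_sqLoss hf).stronglyMeasurable).measurable

theorem starFun_range (Tasks : Set (ProbabilityMeasure (X × Y))) (u : U) (P : Tasks) :
    starFun Tasks (Set.range (h u)) P = ⨅ v, trueError (h u v) P.1 :=
  iInf_range' (fun f => trueError f P.1) (h u)

theorem abs_trueError_sub_le {f g : X → ℝ} (hf : Measurable f) (hg : Measurable g)
    (hf1 : ∀ z : X × Y, sqLoss f z ≤ 1) (hg1 : ∀ z : X × Y, sqLoss g z ≤ 1)
    (hfg : ∀ z : X × Y, |sqLoss f z - sqLoss g z| ≤ τ) (P : ProbabilityMeasure (X × Y)) :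
    |trueError f P - trueError g P| ≤ τ :=
  abs_integral_sub_le (measurable_sqLoss hf) (measurable_sqLoss hg) (sqLoss_nonneg f) hf1
    (sqLoss_nonneg g) hg1 hfg

/-- Closeness of two representations holds for every common output weight `v`, so it survives
integration and the infimum over `v`. No net of output functions enters, hence only `W_R` is
counted. -/
theorem isUniformNet_starFun [Nonempty V]
    (hm : ∀ u v, Measurable (h u v)) (h1 : ∀ u v (z : X × Y), sqLoss (h u v) z ≤ 1)
    (Tasks : Set (ProbabilityMeasure (X × Y)))
    (hGU : IsUniformNet τ (fun u (p : V × (X × Y)) => sqLoss (h u p.1) p.2) GU) :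
    IsUniformNet τ (fun u => starFun Tasks (Set.range (h u))) GU := by
  intro u
  obtain ⟨u', hu', huu⟩ := hGU u
  refine ⟨u', hu', fun P => ?_⟩
  simp only [starFun_range]
  exact abs_iInf_sub_iInf_le (fun v => trueError_nonneg _ _) (fun v => trueError_nonneg _ _)
    fun v => abs_trueError_sub_le (hm u v) (hm u' v) (h1 u v) (h1 u' v) (fun z => huu (v, z)) P.1

theorem capacity_starFamily_le [Nonempty V]
    (hm : ∀ u v, Measurable (h u v)) (h1 : ∀ u v (z : X × Y), sqLoss (h u v) z ≤ 1)
    (Tasks : Set (ProbabilityMeasure (X × Y)))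
    (hGU : IsUniformNet τ (fun u (p : V × (X × Y)) => sqLoss (h u p.1) p.2) GU) {ε : ℝ}
    (hε : τ ≤ ε) :
    capacity ε (starFamily Tasks (Set.range fun u => Set.range (h u))) ≤ GU.card := by
  have hr : starFamily Tasks (Set.range fun u => Set.range (h u)) =
      Set.range fun u => starFun Tasks (Set.range (h u)) := by
    ext F
    constructor
    · rintro ⟨_, ⟨u, rfl⟩, rfl⟩
      exact ⟨u, rfl⟩
    · rintro ⟨u, rfl⟩
      exact ⟨_, ⟨u, rfl⟩, rfl⟩
  rw [hr]
  refine capacity_range_le fun u => ?_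
  obtain ⟨u', hu', huu⟩ := isUniformNet_starFun hm h1 Tasks hGU u
  exact ⟨u', hu', fun P => (huu P).trans hε⟩

/-- The infimum may run over uncountably many weights. Its measurability is needed to compare
integrals over `Q` and to apply Hoeffding's inequality to sampled tasks. -/
theorem measurable_starFun [Nonempty V]
    (hm : ∀ u v, Measurable (h u v)) (h1 : ∀ u v (z : X × Y), sqLoss (h u v) z ≤ 1)
    (Tasks : Set (ProbabilityMeasure (X × Y)))
    (hV : ∀ τ : ℝ, 0 < τ → ∃ G : Finset V,
      IsUniformNet τ (fun v (p : U × (X × Y)) => sqLoss (h p.1 v) p.2) G) (u : U) :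
    Measurable (starFun Tasks (Set.range (h u))) := by
  have heq : starFun Tasks (Set.range (h u)) = fun P => ⨅ v, trueError (h u v) P.1 :=
    funext fun P => starFun_range Tasks u P
  rw [heq]
  refine measurable_iInf_of_nets (fun v => measurable_trueError Tasks (hm u v))
    (fun v P => trueError_nonneg _ _) fun τ hτ => ?_
  obtain ⟨G, hG⟩ := hV τ hτ
  refine ⟨G, fun v => ?_⟩
  obtain ⟨v', hv', hvv⟩ := hG v
  exact ⟨v', hv', fun P => abs_trueError_sub_le (hm u v) (hm u v') (h1 u v) (h1 u v')
    (fun z => hvv (u, z)) P.1⟩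

theorem measurable_empErrorStar [Nonempty V] {n m : ℕ}
    (hm : ∀ u v, Measurable (h u v))
    (hV : ∀ τ : ℝ, 0 < τ → ∃ G : Finset V,
      IsUniformNet τ (fun v (p : U × (X × Y)) => sqLoss (h p.1 v) p.2) G) (u : U) :
    Measurable (empErrorStar (Set.range (h u)) : (Fin n → Fin m → X × Y) → ℝ) := by
  have heq : (empErrorStar (Set.range (h u)) : (Fin n → Fin m → X × Y) → ℝ) =
      fun D => 1 / (n : ℝ) * ∑ i, ⨅ v, empError (h u v) (D i) :=
    funext fun D => empErrorStar_range u D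
  rw [heq]
  refine (Finset.measurable_sum _ fun i _ => ?_).const_mul _
  refine measurable_iInf_of_nets
    (fun v => (measurable_empError (hm u v)).comp (measurable_pi_apply i))
    (fun v D => empError_nonneg _ _) fun τ hτ => ?_
  obtain ⟨G, hG⟩ := hV τ hτ
  refine ⟨G, fun v => ?_⟩
  obtain ⟨v', hv', hvv⟩ := hG v
  exact ⟨v', hv', fun D => abs_average_sub_le hτ.le fun j => hvv (u, D i j)⟩

/-- Uniform convergence for `n` given tasks with a common representation. -/
theorem dataLaw_le
    (hm : ∀ u v, Measurable (h u v)) (h1 : ∀ u v (z : X × Y), sqLoss (h u v) z ≤ 1)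
    {n m : ℕ} (hn : 1 ≤ n) (hm1 : 1 ≤ m) (P : Fin n → ProbabilityMeasure (X × Y))
    {t : ℝ} (hτ : 0 ≤ τ) (ht : 0 ≤ t)
    (hGU : IsUniformNet τ (fun u (p : V × (X × Y)) => sqLoss (h u p.1) p.2) GU)
    (hGV : IsUniformNet τ (fun v (p : U × (X × Y)) => sqLoss (h p.1 v) p.2) GV) :
    dataLaw m P {D | ∃ (u : U) (v : Fin n → V),
        t + 4 * τ < |empErrorN (fun i => h u (v i)) D - trueErrorN (fun i => h u (v i)) P|} ≤
      ENNReal.ofReal ((GU.card * GV.card ^ n : ℕ) *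
        (2 * Real.exp (-2 * (n * m) * t ^ 2))) := by
  rw [← card_tuples]
  refine (measure_mono ?_).trans (uniform_hoeffding_tasks hn hm1 P (τ := 2 * τ)
    (fun a i => measurable_sqLoss (hm a.1 (a.2 i)))
    (fun a z => sqLoss_nonneg _ _) (fun a z => h1 _ _ _) (by positivity) ht
    (isUniformNet_tuples n hGU hGV))
  rintro D ⟨u, v, huv⟩
  refine ⟨(u, v), ?_⟩
  have h4 : t + 2 * (2 * τ) = t + 4 * τ := by ring
  rw [h4]
  exact huv

/-- Uniform convergence for one task with a known representation. -/
theorem sample_le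
    (hm : ∀ u v, Measurable (h u v)) (h1 : ∀ u v (z : X × Y), sqLoss (h u v) z ≤ 1)
    {m : ℕ} (hm1 : 1 ≤ m) (P : ProbabilityMeasure (X × Y)) {t : ℝ} (hτ : 0 ≤ τ)
    (ht : 0 ≤ t) (hGV : IsUniformNet τ (fun v (p : U × (X × Y)) => sqLoss (h p.1 v) p.2) GV)
    (u : U) :
    (Measure.pi fun _ : Fin m => (P : Measure (X × Y)))
        {D | ∃ v, t + 2 * τ < |empError (h u v) D - trueError (h u v) P|} ≤
      ENNReal.ofReal (GV.card * (2 * Real.exp (-2 * m * t ^ 2))) := by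
  refine uniform_hoeffding_sample hm1 (P : Measure (X × Y)) (f := fun v z => sqLoss (h u v) z)
    (fun v => measurable_sqLoss (hm u v)) (fun v z => sqLoss_nonneg _ _) (fun v z => h1 _ _ _)
    hτ ht fun v => ?_
  obtain ⟨v', hv', hvv⟩ := hGV v
  exact ⟨v', hv', fun z => hvv (u, z)⟩

/-- Uniform convergence of the empirical error of a representation to its error on the
environment. -/
theorem environmentLaw_le [Nonempty V]
    (hm : ∀ u v, Measurable (h u v)) (h1 : ∀ u v (z : X × Y), sqLoss (h u v) z ≤ 1)
    {n m : ℕ} (hn : 1 ≤ n) (hm1 : 1 ≤ m)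
    {Tasks : Set (ProbabilityMeasure (X × Y))} (Q : Measure Tasks) [IsProbabilityMeasure Q]
    {t : ℝ} (hτ : 0 ≤ τ) (ht : 0 ≤ t)
    (hGU : IsUniformNet τ (fun u (p : V × (X × Y)) => sqLoss (h u p.1) p.2) GU)
    (hGV : IsUniformNet τ (fun v (p : U × (X × Y)) => sqLoss (h p.1 v) p.2) GV)
    (hV : ∀ τ : ℝ, 0 < τ → ∃ G : Finset V,
      IsUniformNet τ (fun v (p : U × (X × Y)) => sqLoss (h p.1 v) p.2) G) :
    environmentLaw Q n m {D | ∃ u : U, 2 * t + 8 * τ <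
        |empErrorStar (Set.range (h u)) D - trueErrorStar (Set.range (h u)) Q|} ≤
      ENNReal.ofReal (GU.card * (2 * Real.exp (-2 * n * t ^ 2))) +
      ENNReal.ofReal ((GU.card * GV.card ^ n : ℕ) *
        (2 * Real.exp (-2 * (n * m) * t ^ 2))) := by
  have hs0 : ∀ u (P : Tasks), 0 ≤ starFun Tasks (Set.range (h u)) P := fun u P => by
    rw [starFun_range]
    exact Real.iInf_nonneg fun v => trueError_nonneg _ _
  have hs1 : ∀ u (P : Tasks), starFun Tasks (Set.range (h u)) P ≤ 1 := fun u P => by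
    rw [starFun_range]
    exact (ciInf_le ⟨0, by rintro _ ⟨v, rfl⟩; exact trueError_nonneg _ _⟩
      (Classical.arbitrary V)).trans (trueError_le_one (h1 _ _) _)
  have hsm := measurable_starFun hm h1 Tasks hV
  -- Moving to a net point costs `τ` in each error, so `8 τ` drops to `6 τ`. The rest splits into `t
  -- + 2 τ` for sampling tasks and `t + 4 τ` for sampling data.
  let S : U → Set (Fin n → Fin m → X × Y) := fun u =>
    {D | 2 * t + 6 * τ < |empErrorStar (Set.range (h u)) D - trueErrorStar (Set.range (h u)) Q|}
  have hSm : MeasurableSet (⋃ u ∈ GU, S u) := by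
    refine Finset.measurableSet_biUnion _ fun u _ => measurableSet_lt measurable_const ?_
    exact ((measurable_empErrorStar hm hV u).sub_const _).abs
  have hsub : {D | ∃ u : U, 2 * t + 8 * τ <
      |empErrorStar (Set.range (h u)) D - trueErrorStar (Set.range (h u)) Q|} ⊆
      ⋃ u ∈ GU, S u := by
    rintro D ⟨u, hu⟩
    obtain ⟨u', hu', huu⟩ := hGU u
    refine Set.mem_iUnion₂.2 ⟨u', hu', ?_⟩
    change 2 * t + 6 * τ < |_|
    have h2 : |empErrorStar (Set.range (h u)) D - empErrorStar (Set.range (h u')) D| ≤ τ := by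
      rw [empErrorStar_range, empErrorStar_range]
      exact abs_average_sub_le hτ fun i => abs_iInf_sub_iInf_le (fun v => empError_nonneg _ _)
        (fun v => empError_nonneg _ _) fun v => abs_average_sub_le hτ fun j => huu (v, D i j)
    have h3 : |trueErrorStar (Set.range (h u)) Q - trueErrorStar (Set.range (h u')) Q| ≤ τ := by
      refine abs_integral_sub_le (hsm u) (hsm u') (hs0 u) (hs1 u) (hs0 u') (hs1 u') fun P => ?_
      rw [starFun_range, starFun_range]
      exact abs_iInf_sub_iInf_le (fun v => trueError_nonneg _ _) (fun v => trueError_nonneg _ _)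
        fun v => abs_trueError_sub_le (hm u v) (hm u' v) (h1 u v) (h1 u' v)
          (fun z => huu (v, z)) P.1
    rw [abs_le] at h2 h3
    rcases lt_abs.1 hu with h | h
    · exact lt_abs.2 (Or.inl (by linarith))
    · exact lt_abs.2 (Or.inr (by linarith))
  let bad : Set (Fin n → Tasks) := {P | ∃ u, t + 2 * τ <
    |1 / (n : ℝ) * ∑ i, starFun Tasks (Set.range (h u)) (P i) -
      ∫ P, starFun Tasks (Set.range (h u)) P ∂Q|}
  have hbad : (Measure.pi fun _ : Fin n => Q) bad ≤
      ENNReal.ofReal (GU.card * (2 * Real.exp (-2 * n * t ^ 2))) :=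
    uniform_hoeffding_sample hn Q hsm hs0 hs1 hτ ht (isUniformNet_starFun hm h1 Tasks hGU)
  set c := ENNReal.ofReal ((GU.card * GV.card ^ n : ℕ) *
    (2 * Real.exp (-2 * (n * m) * t ^ 2))) with hc
  -- For unrepresentative tasks the trivial bound 1 suffices, since such tasks are rare by `hbad`;
  -- for the others the data alone must deviate.
  have hpt : ∀ P : Fin n → Tasks, dataKernel Tasks n m P (⋃ u ∈ GU, S u) ≤
      bad.indicator 1 P + c := by
    intro P
    by_cases hP : P ∈ bad
    · rw [Set.indicator_of_mem hP]
      have : IsProbabilityMeasure (dataKernel Tasks n m P) :=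
        inferInstanceAs (IsProbabilityMeasure (Measure.pi fun i =>
          Measure.pi fun _ : Fin m => ((P i).1 : Measure (X × Y))))
      exact prob_le_one.trans le_self_add
    · rw [Set.indicator_of_notMem hP, zero_add]
      refine (measure_mono ?_).trans
        (dataLaw_le hm h1 hn hm1 (fun i => (P i).1) hτ ht hGU hGV)
      intro D hD
      obtain ⟨u, -, hu⟩ := Set.mem_iUnion₂.1 hD
      by_contra hcon
      have hle : ∀ v : Fin n → V, |1 / (n : ℝ) * ∑ i, empError (h u (v i)) (D i) -
          1 / (n : ℝ) * ∑ i, trueError (h u (v i)) (P i).1| ≤ t + 4 * τ := by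
        intro v
        by_contra hv
        exact hcon ⟨u, v, not_le.1 hv⟩
      have h2 := abs_average_iInf_sub_le hn (f := fun i v => empError (h u v) (D i))
        (g := fun i v => trueError (h u v) (P i).1) (fun i v => empError_nonneg _ _)
        (fun i v => trueError_nonneg _ _) hle
      have h3 : |1 / (n : ℝ) * ∑ i, starFun Tasks (Set.range (h u)) (P i) -
          ∫ P, starFun Tasks (Set.range (h u)) P ∂Q| ≤ t + 2 * τ := by
        by_contra hv
        exact hP ⟨u, not_le.1 hv⟩
      have h4 : 2 * t + 6 * τ <
          |empErrorStar (Set.range (h u)) D - trueErrorStar (Set.range (h u)) Q| := hu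
      rw [empErrorStar_range] at h4
      simp_rw [starFun_range] at h3
      unfold trueErrorStar at h4
      simp_rw [starFun_range] at h4
      have h5 := abs_sub_le (1 / (n : ℝ) * ∑ i, ⨅ v, empError (h u v) (D i))
        (1 / (n : ℝ) * ∑ i, ⨅ v, trueError (h u v) (P i).1)
        (∫ P : Tasks, ⨅ v, trueError (h u v) P.1 ∂Q)
      linarith
  refine (measure_mono hsub).trans ?_
  -- Disintegration requires a measurable event, which is why the event was first enlarged to a
  -- finite union over the net.
  rw [environmentLaw, Measure.bind_apply hSm (dataKernel Tasks n m).measurable.aemeasurable]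
  calc ∫⁻ P, dataKernel Tasks n m P (⋃ u ∈ GU, S u) ∂(Measure.pi fun _ : Fin n => Q)
      ≤ ∫⁻ P, (bad.indicator 1 P + c) ∂(Measure.pi fun _ : Fin n => Q) := lintegral_mono hpt
    _ = ∫⁻ P, bad.indicator 1 P ∂(Measure.pi fun _ : Fin n => Q) + c := by
      rw [lintegral_add_right _ measurable_const]
      simp
    _ ≤ _ := by
      gcongr
      exact (lintegral_indicator_one_le bad).trans hbad

end Loss

/-! ### Parametrisation of the family by weights, and its nets. -/

theorem family_eq_range {d k : ℕ} (R : Network d k) (O : Network k 1) (B : ℝ)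
    (X : Set (Fin d → ℝ)) :
    family R O B X = Set.range fun u : R.weights B =>
      Set.range fun v : O.weights B => hypothesis R O X u.1 v.1 := by
  have hH : ∀ u, hypothesisSpace R O B X u =
      Set.range fun v : O.weights B => hypothesis R O X u v.1 := by
    intro u
    ext f
    constructor
    · rintro ⟨v, hv, rfl⟩
      exact ⟨⟨v, hv⟩, rfl⟩
    · rintro ⟨v, rfl⟩
      exact ⟨v.1, v.2, rfl⟩
  ext H
  constructor
  · rintro ⟨u, hu, rfl⟩
    exact ⟨⟨u, hu⟩, (hH u).symm⟩
  · rintro ⟨u, rfl⟩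
    exact ⟨u.1, u.2, (hH u.1).symm⟩

/-- The admissible weights of a network have finite nets in the supremum norm. -/
theorem exists_net_weights {d k : ℕ} (N : Network d k) {B η : ℝ} (hB : 0 ≤ B) (hη : 0 < η) :
    ∃ G : Finset (N.weights B), (G.card : ℝ) ≤ (2 * B / η + 2) ^ N.numWeights ∧
      ∀ w : N.weights B, ∃ g ∈ G, ∀ e, |w.1 e - g.1 e| ≤ η := by
  obtain ⟨G, hG, hG'⟩ := exists_net_cube (ι := N.nodes.Edge) hB hη
  rw [N.nodes.card_edge] at hG
  exact ⟨G, hG, hG'⟩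

/-- The family of hypothesis spaces is parametrized by the weights, and there are nets of the
representations and of the output networks that are uniform for the squared loss; the constant `L`
does not depend on `Y`. -/
theorem exists_parametrization {d k : ℕ} (R : Network d k) (O : Network k 1)
    (hR : R.nodes.AllLipschitz) (hO : O.nodes.AllLipschitz) {B : ℝ} (hB : 0 ≤ B)
    {X : Set (Fin d → ℝ)} (hX : Bornology.IsBounded X) :
    ∃ (h : R.weights B → O.weights B → X → ℝ) (L : ℝ), 0 < L ∧
      family R O B X = (Set.range fun u => Set.range (h u)) ∧ (∀ u v, Measurable (h u v)) ∧
      ∀ Y : Set ℝ, (∀ u v (z : X × Y), sqLoss (h u v) z ≤ 1) →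
      ∀ τ : ℝ, 0 < τ → ∃ (GU : Finset (R.weights B)) (GV : Finset (O.weights B)),
        (GU.card : ℝ) ≤ (L / τ + 2) ^ R.numWeights ∧ (GV.card : ℝ) ≤ (L / τ + 2) ^ O.numWeights ∧
        IsUniformNet τ (fun u (p : O.weights B × (X × Y)) => sqLoss (h u p.1) p.2) GU ∧
        IsUniformNet τ (fun v (p : R.weights B × (X × Y)) => sqLoss (h p.1 v) p.2) GV := by
  obtain ⟨L, hL, hlip⟩ := exists_hypothesis_lipschitz R O hR hO B hX
  refine ⟨fun u v => hypothesis R O X u.1 v.1, 4 * L * B + 1, by positivity,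
    family_eq_range R O B X, fun u v => (continuous_hypothesis hR hO X u.1 v.1).measurable,
    fun Y hY τ hτ => ?_⟩
  -- Weights within `η` give hypotheses within `L η = τ / 2`, and the squared loss doubles this.
  have hη : 0 < τ / (2 * L) := by positivity
  obtain ⟨GU, hGU, hGU'⟩ := exists_net_weights R hB hη
  obtain ⟨GV, hGV, hGV'⟩ := exists_net_weights O hB hη
  have hbase : 2 * B / (τ / (2 * L)) + 2 ≤ (4 * L * B + 1) / τ + 2 := by
    have h1 : 2 * B / (τ / (2 * L)) = 4 * L * B / τ := by field_simp; ring
    rw [h1]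
    gcongr
    linarith
  have h0 : 0 ≤ 2 * B / (τ / (2 * L)) + 2 := by positivity
  have hLη : 2 * (L * (τ / (2 * L))) = τ := by field_simp
  refine ⟨GU, GV, hGU.trans (by gcongr), hGV.trans (by gcongr), fun u => ?_, fun v => ?_⟩
  · obtain ⟨u', hu', huu⟩ := hGU' u
    refine ⟨u', hu', fun p => (abs_sqLoss_sub_le (hY u p.1 p.2) (hY u' p.1 p.2)).trans ?_⟩
    have := hlip u u.2 u' u'.2 p.1 p.1.2 p.1 p.1.2 _ hη.le huu
      (fun e => by rw [sub_self, abs_zero]; exact hη.le) p.2.1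
    linarith
  · obtain ⟨v', hv', hvv⟩ := hGV' v
    refine ⟨v', hv', fun p => (abs_sqLoss_sub_le (hY p.1 v p.2) (hY p.1 v' p.2)).trans ?_⟩
    have := hlip p.1 p.1.2 p.1 p.1.2 v v.2 v' v'.2 _ hη.le
      (fun e => by rw [sub_self, abs_zero]; exact hη.le) hvv p.2.1
    linarith

/-! ### Arithmetic of the sample sizes. -/

theorem log_natCast_le {N W : ℕ} {ε : ℝ} (hε : 0 < ε) (hε1 : ε ≤ 1)
    (hN : (N : ℝ) ≤ (1 / ε) ^ (2 * W)) : Real.log N ≤ 2 * W * Real.log (1 / ε) := by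
  have hlog : 0 ≤ Real.log (1 / ε) := Real.log_nonneg (by rw [le_div_iff₀ hε]; linarith)
  rcases Nat.eq_zero_or_pos N with rfl | h0
  · rw [Nat.cast_zero, Real.log_zero]
    positivity
  · refine (Real.log_le_log (by exact_mod_cast h0) hN).trans_eq ?_
    rw [Real.log_pow]
    push_cast
    ring

theorem examplesPerTask_mul {WO WR n : ℕ} (hn : 1 ≤ n) (ε δ : ℝ) :
    n * examplesPerTask WO WR n ε δ =
      1 / ε ^ 2 * (((WR + n * WO : ℕ) : ℝ) * Real.log (1 / ε) + Real.log (1 / δ)) := by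
  have hn' : (n : ℝ) ≠ 0 := by positivity
  unfold examplesPerTask
  push_cast
  field_simp
  ring

theorem examplesPerTask_le {WO WR n : ℕ} (hn : 1 ≤ n) {ε δ : ℝ} (hδ : 0 < δ) (hδ1 : δ < 1) :
    examplesPerTask WO WR n ε δ ≤ 1 / ε ^ 2 * (WO * Real.log (1 / ε) + Real.log (1 / δ)) +
      1 / ε ^ 2 * (WR * Real.log (1 / ε)) / n := by
  have hn' : (1 : ℝ) ≤ n := by exact_mod_cast hn
  have hlog : 0 ≤ Real.log (1 / δ) := Real.log_nonneg (by rw [le_div_iff₀ hδ]; linarith)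
  have h1 : 1 / (n : ℝ) * Real.log (1 / δ) ≤ 1 * Real.log (1 / δ) := by
    gcongr
    rw [div_le_one (by linarith)]
    exact hn'
  unfold examplesPerTask
  calc 1 / ε ^ 2 * (((WO : ℝ) + WR / n) * Real.log (1 / ε) + 1 / n * Real.log (1 / δ))
      ≤ 1 / ε ^ 2 * (((WO : ℝ) + WR / n) * Real.log (1 / ε) + 1 * Real.log (1 / δ)) := by gcongr
    _ = _ := by ring

end BiasLearning

end

open BiasLearning in
/-- Learning `n` tasks with a common internal representation. `R` is the representation network,
`O` the architecture of the output networks; weights lie in `[-B, B]` and all nodes are Lipschitz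
bounded. The constant `K` is absolute, and the bounds hold for all small `ε`, where "small" does not
depend on `n`, `m`, `δ` or the environment. -/
theorem mainTheorem2 :
    ∃ K : ℝ, 0 < K ∧
    ∀ (d k : ℕ) (R : Network d k) (O : Network k 1) (B : ℝ) (X : Set (Fin d → ℝ)),
      R.nodes.AllLipschitz → O.nodes.AllLipschitz →
      1 ≤ R.numWeights → 1 ≤ O.numWeights →
      0 ≤ B → Bornology.IsBounded X →
    ∃ ε₀ : ℝ, 0 < ε₀ ∧ ε₀ < 1 ∧
    ∀ Y : Set ℝ,
      (∀ H ∈ family R O B X, ∀ h ∈ H, ∀ z : X × Y, sqLoss h z ≤ 1) →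
    ∀ ε : ℝ, 0 < ε → ε ≤ ε₀ →
      -- the capacity of `[ℍⁿ]_σ`
      (∀ n : ℕ, 1 ≤ n →
        capacity ε (productFamily Y n (family R O B X)) ≠ ⊤ ∧
        Real.log ((capacity ε (productFamily Y n (family R O B X))).toNat : ℝ) ≤
          K * (n * ((O.numWeights : ℝ) + R.numWeights / n)) * Real.log (1 / ε)) ∧
      -- the capacity of `ℍ*`
      (∀ Tasks : Set (ProbabilityMeasure (X × Y)),
        capacity ε (starFamily Tasks (family R O B X)) ≠ ⊤ ∧
        Real.log ((capacity ε (starFamily Tasks (family R O B X))).toNat : ℝ) ≤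
          K * R.numWeights * Real.log (1 / ε)) ∧
      ∀ δ : ℝ, 0 < δ → δ < 1 →
        -- generalisation on average over `n` given tasks
        (∀ n m : ℕ, 1 ≤ n →
          K * examplesPerTask O.numWeights R.numWeights n ε δ ≤ m →
          ∀ P : Fin n → ProbabilityMeasure (X × Y),
            dataLaw m P {D | ∃ H ∈ family R O B X, ∃ h : Fin n → X → ℝ, (∀ i, h i ∈ H) ∧
              ε < |empErrorN h D - trueErrorN h P|} ≤ ENNReal.ofReal δ) ∧
        -- the form `a + b / n`; `O(a)` examples suffice for one task with a known representation
        (∃ a b : ℝ,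
          a = 1 / ε ^ 2 * (O.numWeights * Real.log (1 / ε) + Real.log (1 / δ)) ∧
          b = 1 / ε ^ 2 * (R.numWeights * Real.log (1 / ε)) ∧
          (∀ n : ℕ, 1 ≤ n →
            examplesPerTask O.numWeights R.numWeights n ε δ ≤ a + b / n) ∧
          examplesPerTask O.numWeights R.numWeights 1 ε δ = a + b ∧
          ∀ H ∈ family R O B X, ∀ m : ℕ, K * a ≤ m →
            ∀ P : ProbabilityMeasure (X × Y),
              (Measure.pi fun _ : Fin m => (P : Measure (X × Y)))
                {D | ∃ h ∈ H, ε < |empError h D - trueError h P|} ≤ ENNReal.ofReal δ) ∧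
        -- generalisation to novel tasks of the environment `(Tasks, Q)`, for every choice of `H ∈ ℍ`,
        -- in particular for one that minimises the empirical error; the term `ln (1/δ)` in the
        -- number of tasks is not needed unless `δ < ε ^ W_R`
        (∀ n m : ℕ, 1 ≤ n →
          (K * (1 / ε ^ 2 * (R.numWeights * Real.log (1 / ε) + Real.log (1 / δ))) ≤ n ∨
            (ε ^ R.numWeights ≤ δ ∧
              K * (1 / ε ^ 2 * (R.numWeights * Real.log (1 / ε))) ≤ n)) →
          K * examplesPerTask O.numWeights R.numWeights n ε δ ≤ m →
          ∀ (Tasks : Set (ProbabilityMeasure (X × Y))) (Q : Measure Tasks), IsProbabilityMeasure Q →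
            environmentLaw Q n m {D | ∃ H ∈ family R O B X,
              ε < |empErrorStar H D - trueErrorStar H Q|} ≤ ENNReal.ofReal δ) := by
  -- `card_mul_exp_le` asks for `8 (4 W ln (1/ε) + ln (1/δ))`; if `ln (1/δ) ≤ W ln (1/ε)`, this is
  -- at most `40 W ln (1/ε)`.
  refine ⟨40, by norm_num, ?_⟩
  intro d k R O B X hR hO hWR hWO hB hX
  obtain ⟨h, L, hL, hfam, hm, hnets⟩ := exists_parametrization R O hR hO hB hX
  have hpos : 0 < 16 * L + 2 := by positivity
  have hhalf : 1 / (16 * L + 2) ≤ 1 / 2 := by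
    rw [div_le_div_iff₀ hpos two_pos]
    linarith
  -- This threshold is what makes `16 L / ε + 2 ≤ (1/ε)²`.
  refine ⟨1 / (16 * L + 2), by positivity, by linarith, ?_⟩
  intro Y hY ε hε hεle
  rw [hfam] at hY ⊢
  have h1 : ∀ u v (z : X × Y), sqLoss (h u v) z ≤ 1 := fun u v z =>
    hY _ ⟨u, rfl⟩ _ ⟨v, rfl⟩ z
  have : Nonempty (O.weights B) := ⟨⟨fun _ => 0, fun _ => by simpa using hB⟩⟩
  have hε2 : ε ≤ 1 / 2 := hεle.trans hhalf
  have hε1 : ε ≤ 1 := by linarith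
  have hlog : 0 < Real.log (1 / ε) := Real.log_pos (by rw [lt_div_iff₀ hε]; linarith)
  -- With `t = ε / 4` and `τ = ε / 16` the largest error budget, `2 t + 8 τ`, equals `ε`.
  obtain ⟨GU, GV, hcU, hcV, hGU, hGV⟩ := hnets Y h1 (ε / 16) (by positivity)
  have hV : ∀ τ : ℝ, 0 < τ → ∃ G : Finset (O.weights B), IsUniformNet τ
      (fun v (p : R.weights B × (X × Y)) => sqLoss (h p.1 v) p.2) G := fun τ hτ =>
    let ⟨_, G, _, _, _, hG⟩ := hnets Y h1 τ hτ
    ⟨G, hG⟩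
  have hbase : L / (ε / 16) + 2 ≤ (1 / ε) ^ 2 := by
    rw [le_div_iff₀ hpos] at hεle
    have h2 : L / (ε / 16) + 2 = (16 * L + 2 * ε) / ε := by field_simp
    have h3 : (1 / ε) ^ 2 = 1 / ε / ε := by field_simp
    rw [h2, h3]
    gcongr
    rw [le_div_iff₀ hε]
    nlinarith
  have hbase0 : 0 ≤ L / (ε / 16) + 2 := by positivity
  have hcU' : (GU.card : ℝ) ≤ (1 / ε) ^ (2 * R.numWeights) := by
    rw [pow_mul]
    exact hcU.trans (by gcongr)
  have hcV' : (GV.card : ℝ) ≤ (1 / ε) ^ (2 * O.numWeights) := by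
    rw [pow_mul]
    exact hcV.trans (by gcongr)
  have hcT : ∀ n : ℕ, ((GU.card * GV.card ^ n : ℕ) : ℝ) ≤
      (1 / ε) ^ (2 * (R.numWeights + n * O.numWeights)) := by
    intro n
    push_cast
    calc (GU.card : ℝ) * (GV.card : ℝ) ^ n
        ≤ (1 / ε) ^ (2 * R.numWeights) * ((1 / ε) ^ (2 * O.numWeights)) ^ n := by gcongr
      _ = _ := by rw [← pow_mul, ← pow_add]; congr 1; ring
  refine ⟨fun n hn => ?_, fun Tasks => ?_, fun δ hδ hδ1 => ?_⟩
  · have hn' : (0 : ℝ) < n := by exact_mod_cast hn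
    refine log_toNat_le
      (capacity_productFamily_le n (by positivity) hGU hGV (by linarith)) ?_ (by positivity)
    refine (log_natCast_le hε hε1 (hcT n)).trans ?_
    have h2 : (n : ℝ) * (O.numWeights + R.numWeights / n) =
        ((R.numWeights + n * O.numWeights : ℕ) : ℝ) := by
      push_cast
      field_simp
      ring
    rw [h2]
    gcongr
    norm_num
  · refine log_toNat_le (capacity_starFamily_le hm h1 Tasks hGU (by linarith)) ?_ (by positivity)
    refine (log_natCast_le hε hε1 hcU').trans ?_
    gcongr
    norm_num
  have hlogδ : 0 < Real.log (1 / δ) := Real.log_pos (by rw [lt_div_iff₀ hδ]; linarith)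
  have hnat : ∀ {b : ℝ} {m : ℕ}, 0 < b → b ≤ m → 1 ≤ m := fun hb hbm =>
    Nat.one_le_iff_ne_zero.2 fun h0 => by subst h0; simp at hbm; linarith
  have htasks : ∀ n m : ℕ, 1 ≤ n →
      40 * examplesPerTask O.numWeights R.numWeights n ε δ ≤ m → 1 ≤ m ∧
      ((GU.card * GV.card ^ n : ℕ) : ℝ) * (2 * Real.exp (-2 * (n * m) * (ε / 4) ^ 2)) ≤
        δ / 2 := by
    intro n m hn hnm
    have hn' : (0 : ℝ) < n := by exact_mod_cast hn
    refine ⟨hnat (by unfold examplesPerTask; positivity) hnm,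
      card_mul_exp_le (W := R.numWeights + n * O.numWeights) (by omega) hε hε2 hδ (hcT n) ?_⟩
    -- The tail bound involves the total sample size `n m`; multiplied by `n`, the number of
    -- examples per task takes the form for `W_R + n W_O` weights.
    have h2 := mul_le_mul_of_nonneg_left hnm hn'.le
    rw [mul_left_comm, examplesPerTask_mul hn] at h2
    refine le_trans ?_ h2
    rw [mul_left_comm, mul_left_comm (40 : ℝ)]
    have h3 : 0 ≤ ((R.numWeights + n * O.numWeights : ℕ) : ℝ) * Real.log (1 / ε) := by positivity
    exact mul_le_mul_of_nonneg_left (by linarith) (by positivity)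
  refine ⟨fun n m hn hnm P => ?_, ⟨_, _, rfl, rfl, fun n hn => examplesPerTask_le hn hδ hδ1, ?_, ?_⟩,
    fun n m hn hcond hnm Tasks Q hQ => ?_⟩
  · obtain ⟨hm1, hbd⟩ := htasks n m hn hnm
    refine (measure_mono ?_).trans ((dataLaw_le hm h1 hn hm1 P (t := ε / 4) (by positivity)
      (by positivity) hGU hGV).trans (ENNReal.ofReal_le_ofReal (hbd.trans (by linarith))))
    rintro D ⟨_, ⟨u, rfl⟩, f, hf, hD⟩
    choose v hv using hf
    obtain rfl : (fun i => h u (v i)) = f := funext hv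
    exact ⟨u, v, lt_of_le_of_lt (by linarith) hD⟩
  · unfold examplesPerTask
    push_cast
    ring
  · rintro _ ⟨u, rfl⟩ m hma P
    have hm1 : 1 ≤ m := hnat (by positivity) hma
    have hbd := card_mul_exp_le (M := m) hWO hε hε2 hδ hcV' (by
      refine le_trans ?_ hma
      rw [mul_left_comm, mul_left_comm (40 : ℝ)]
      have h3 : 0 ≤ (O.numWeights : ℝ) * Real.log (1 / ε) := by positivity
      exact mul_le_mul_of_nonneg_left (by linarith) (by positivity))
    refine (measure_mono ?_).trans ((sample_le hm h1 hm1 P (t := ε / 4) (by positivity)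
      (by positivity) hGV u).trans (ENNReal.ofReal_le_ofReal (hbd.trans (by linarith))))
    rintro D ⟨_, ⟨v, rfl⟩, hD⟩
    exact ⟨v, lt_of_le_of_lt (by linarith) hD⟩
  · obtain ⟨hm1, hbd⟩ := htasks n m hn hnm
    have hbU := card_mul_exp_le (M := n) hWR hε hε2 hδ hcU' (by
      have h3 : 0 ≤ (R.numWeights : ℝ) * Real.log (1 / ε) := by positivity
      rcases hcond with hc | ⟨hδε, hc⟩
      · refine le_trans ?_ hc
        rw [mul_left_comm, mul_left_comm (40 : ℝ)]
        exact mul_le_mul_of_nonneg_left (by linarith) (by positivity)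
      · refine le_trans ?_ hc
        rw [mul_left_comm, mul_left_comm (40 : ℝ)]
        have h4 : Real.log (1 / δ) ≤ R.numWeights * Real.log (1 / ε) := by
          rw [← Real.log_pow, one_div_pow]
          exact Real.log_le_log (by positivity) (by gcongr)
        exact mul_le_mul_of_nonneg_left (by linarith) (by positivity))
    have henv := environmentLaw_le hm h1 hn hm1 Q (t := ε / 4) (by positivity) (by positivity)
      hGU hGV hV
    refine (measure_mono ?_).trans (henv.trans ?_)
    · rintro D ⟨_, ⟨u, rfl⟩, hD⟩
      exact ⟨u, lt_of_le_of_lt (by linarith) hD⟩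
    -- The failures of task sampling and of data sampling each have probability at most `δ / 2`.
    · rw [← ENNReal.ofReal_add (by positivity) (by positivity)]
      exact ENNReal.ofReal_le_ofReal (by linarith)
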